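/- **Setting.** Let $W=(\beta^1,\dots,\beta^N)^\top$ be a vector of independent standard Brownian motions on a probability space $(\Omega,\mathcal F,\mathbb P)$, let $A=-\mathrm{diag}(\lambda_1,\dots,\lambda_N)$ with all $\lambda_p>0$ and $Q=\mathrm{diag}(\sigma_1^2,\dots,\sigma_N^2)$ with all $\sigma_p^2>0$. Let $T>0$, let $f\colon[0,T]\to\mathbb R^N$ be continuous, let $B_0\colon[0,T]\times\mathbb R^N\to\mathbb R^N$ be bounded with $B_0(r,\cdot)$ continuous for every $r$, put $B=B_0-f$, and let $u_0\colon\mathbb R^N\to\mathbb R$ be bounded and Borel measurable. Let $\mathbb S$ be the set of strictly increasing càdlàg functions $\ell\colon\mathbb R_+\to\mathbb R$ with $\ell_0=0$. For $\ell\in\mathbb S$, $0\le a<T$ and $x\in\mathbb R^N$ let $(Z^\ell_r(a,x))_{r\in[a,T]}$ be the càdlàg solution of $$dZ^\ell_r(a,x)=\big(AZ^\ell_r(a,x)+f(r)\big)dr+\sqrt Q\,dW_{\ell_r},\qquad Z^\ell_a(a,x)=x,$$ and for $0\le a<b\le T$ let $$F_{a,b}=\int_a^b e^{(b-r)A}f(r)\,dr,\qquad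 I^\ell_{a,b}=\int_{(a,b]}e^{2(b-r)A}Q\,d\ell_r\in\mathbb R^{N\times N}.$$ **Iterated functions.** Let $n\ge1$ be an integer and $t\in(0,T]$. For $0\le s_{n+1}<t$ and $\ell^0\in\mathbb S$ put $$k^{\ell^0}_{s_{n+1},t}(y)=\big\langle B(s_{n+1},y),\nabla_y\,\mathbb E\big[u_0\big(Z^{\ell^0}_t(s_{n+1},y)\big)\big]\big\rangle,\qquad y\in\mathbb R^N,$$ and for $1\le i\le n$, $0\le s_{n-i+1}<\dots<s_{n+1}<t$ and $\ell^0,\dots,\ell^i\in\mathbb S$ put $$k^{\ell^0,\dots,\ell^i}_{s_{n-i+1},\dots,s_{n+1},t}(y)=\Big\langle B(s_{n-i+1},y),\nabla_y\,\mathbb E\Big[k^{\ell^0,\dots,\ell^{i-1}}_{s_{n-i+2},\dots,s_{n+1},t}\big(Z^{\ell^i}_{s_{n-i+2}}(s_{n-i+1},y)\big)\Big]\Big\rangle,\qquad y\in\mathbb R^N.$$ **Lemma.** Let $0\le s<t\le T$ and let $n\ge1$ be an integer. Let $x\in\mathbb R^N$, $i\in\{0,\dots,n\}$, $s\le s_{n-i}<s_{n-i+1}<\dots<s_{n+1}<t$,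 $s_{n+2}=t$, and $\ell^0,\dots,\ell^{i+1}\in\mathbb S$. For $j=0,\dots,i+1$ write $\tau_j=s_{n+2-j}$, so that $\tau_0=t$ and $\tau_{i+1}=s_{n-i+1}$; write $Z_r=Z^{\ell^{i+1}}_r(s_{n-i},x)$, and put $$G_j=\big(I^{\ell^{i+1}}_{\tau_j,\tau_{j-1}}\big)^{-\frac12}\big(Z_{\tau_{j-1}}-e^{(\tau_{j-1}-\tau_j)A}Z_{\tau_j}-F_{\tau_j,\tau_{j-1}}\big),\qquad j=1,\dots,i+1,$$ $$Y_j=\sum_{k=j+1}^{i+1}e^{(\tau_j-\tau_{k-1})A}\Big[F_{\tau_k,\tau_{k-1}}+\big(I^{\ell^{k-1}}_{\tau_k,\tau_{k-1}}\big)^{\frac12}G_k\Big]+e^{(\tau_j-\tau_{i+1})A}Z_{\tau_{i+1}},\qquad j=0,\dots,i+1,$$ where an empty sum is $0$. Then the expectations and gradients in the definition of $k^{\ell^0,\dots,\ell^i}_{s_{n-i+1},\dots,s_{n+1},t}$ exist, the random variable in the conditional expectation below is integrable, and, $\mathbb P$-a.s., $$k^{\ell^0,\dots,\ell^i}_{s_{n-i+1},\dots,s_{n+1},t}\big(Z_{s_{n-i+1}}\big)=\mathbb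 E\Big[u_0(Y_0)\prod_{j=1}^{i+1}\Big\langle\big(I^{\ell^{j-1}}_{\tau_j,\tau_{j-1}}\big)^{-\frac12}e^{(\tau_{j-1}-\tau_j)A}B(\tau_j,Y_j),\,G_j\Big\rangle\;\Big|\;\sigma\big(Z_{s_{n-i+1}}\big)\Big].$$ -/

import Mathlib

open MeasureTheory ProbabilityTheory Set Filter Topology
open scoped NNReal RealInnerProductSpace MatrixOrder

noncomputable section

namespace OUIter

/-- A function that is right-continuous and has left limits at every point of `S`,
relative to `S`. -/
def IsCadlagOn {X F : Type*} [TopologicalSpace X] [Preorder X] [TopologicalSpace F]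
    (g : X → F) (S : Set X) : Prop :=
  ∀ t ∈ S, ContinuousWithinAt g (S ∩ Ici t) t ∧ ∃ l : F, Tendsto g (𝓝[S ∩ Iio t] t) (𝓝 l)

/-- The set `𝕊` of real-valued, strictly increasing càdlàg functions on `ℝ₊` starting at `0`. -/
structure TimeChange where
  toFun : ℝ≥0 → ℝ
  strictMono : StrictMono toFun
  cadlag : IsCadlagOn toFun univ
  map_zero : toFun 0 = 0

/-- The time change extended to `ℝ` by `0` on the negative half-line, as a Stieltjes function:
`ℓ.stieltjes.measure` is the Lebesgue-Stieltjes measure `dℓ`. -/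
def TimeChange.stieltjes (ℓ : TimeChange) : StieltjesFunction ℝ where
  toFun r := ℓ.toFun r.toNNReal
  mono' _ _ h := ℓ.strictMono.monotone (Real.toNNReal_le_toNNReal h)
  right_continuous' r := by
    have h := (ℓ.cadlag r.toNNReal (mem_univ _)).1
    exact h.comp (by fun_prop : Continuous Real.toNNReal).continuousWithinAt
      fun _ hy => ⟨mem_univ _, Real.toNNReal_le_toNNReal hy⟩

variable {N : ℕ}

/-- The action of an `N × N` matrix on `ℝ^N` with its Euclidean structure. -/
def act (M : Matrix (Fin N) (Fin N) ℝ) (x : EuclideanSpace ℝ (Fin N)) :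
    EuclideanSpace ℝ (Fin N) :=
  WithLp.toLp 2 (Matrix.mulVec M x.ofLp)

/-- The matrix `e^{rA}`. -/
def expMat (A : Matrix (Fin N) (Fin N) ℝ) (r : ℝ) : Matrix (Fin N) (Fin N) ℝ :=
  NormedSpace.exp (r • A)

/-- `M^{1/2}`, for a positive semidefinite `M`. -/
def sqrtMat (M : Matrix (Fin N) (Fin N) ℝ) : Matrix (Fin N) (Fin N) ℝ :=
  CFC.sqrt M

/-- `M^{-1/2}`, for a positive definite `M`. -/
def invSqrtMat (M : Matrix (Fin N) (Fin N) ℝ) : Matrix (Fin N) (Fin N) ℝ :=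
  (sqrtMat M)⁻¹

/-- `F_{a,b} = ∫_a^b e^{(b-r)A} f(r) dr`. -/
def driftInt (A : Matrix (Fin N) (Fin N) ℝ) (f : ℝ → EuclideanSpace ℝ (Fin N)) (a b : ℝ) :
    EuclideanSpace ℝ (Fin N) :=
  ∫ r in a..b, act (expMat A (b - r)) (f r)

/-- `I^ℓ_{a,b} = ∫_a^b e^{2(b-r)A} Q dℓ_r`, a Lebesgue-Stieltjes integral over `(a, b]`,
taken entry by entry. -/
def covMat (A Q : Matrix (Fin N) (Fin N) ℝ) (ℓ : TimeChange) (a b : ℝ) :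
    Matrix (Fin N) (Fin N) ℝ :=
  Matrix.of fun p q => ∫ r in Ioc a b, (expMat A (2 * (b - r)) * Q) p q ∂ℓ.stieltjes.measure

variable {Ω : Type*} [MeasurableSpace Ω]

/-- `W = (β^1, …, β^N)ᵀ`, where `β^1, …, β^N` are independent standard Brownian motions. -/
structure IsBrownianVector (W : ℝ≥0 → Ω → EuclideanSpace ℝ (Fin N)) (P : Measure Ω) : Prop where
  measurable : ∀ r, Measurable (W r)
  brownian : ∀ p : Fin N, IsBrownianReal (fun r ω => W r ω p) P
  indep : iIndepFun (fun (p : Fin N) (ω : Ω) (r : ℝ≥0) => W r ω p) P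

/-- `z = (z_t)`, `t ∈ [a,T]`, is the càdlàg solution of the linear stochastic differential equation
`dz_t = (A z_t + f(t)) dt + √Q dW_{ℓ_t}`, `z_a = x`. As the noise is additive, the equation in
integral form needs no stochastic integral. -/
structure IsOUProcess (A Q : Matrix (Fin N) (Fin N) ℝ) (f : ℝ → EuclideanSpace ℝ (Fin N)) (T : ℝ)
    (W : ℝ≥0 → Ω → EuclideanSpace ℝ (Fin N)) (P : Measure Ω) (ℓ : TimeChange) (a : ℝ)
    (x : EuclideanSpace ℝ (Fin N)) (z : ℝ → Ω → EuclideanSpace ℝ (Fin N)) : Prop where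
  measurable : ∀ t ∈ Icc a T, Measurable (z t)
  cadlag : ∀ᵐ ω ∂P, IsCadlagOn (fun t => z t ω) (Icc a T)
  eqn : ∀ᵐ ω ∂P, ∀ t ∈ Icc a T,
    z t ω = x + (∫ r in a..t, (act A (z r ω) + f r))
      + act (sqrtMat Q) (W (ℓ.toFun t.toNNReal).toNNReal ω - W (ℓ.toFun a.toNNReal).toNNReal ω)

/-- The iterated functions, for times listed backwards, `τ 0 > τ 1 > ⋯ ≥ 0`. Here `Z ℓ a y` is
the Ornstein-Uhlenbeck process with time change `ℓ` that starts from `y` at time `a`.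
`kIter 0 = u₀` and `kIter (m + 1) y = ⟨B(τ_{m+1}, y), ∇ E[kIter m (Z^{ℓ^m}_{τ_m}(τ_{m+1}, y))]⟩`,
so that `kIter (i + 1)` is the function `k^{ℓ^0,…,ℓ^i}_{τ_{i+1},…,τ_1,τ_0}`. -/
def kIter (P : Measure Ω)
    (Z : TimeChange → ℝ → EuclideanSpace ℝ (Fin N) → ℝ → Ω → EuclideanSpace ℝ (Fin N))
    (B : ℝ → EuclideanSpace ℝ (Fin N) → EuclideanSpace ℝ (Fin N))
    (u₀ : EuclideanSpace ℝ (Fin N) → ℝ) (ℓ : ℕ → TimeChange) (τ : ℕ → ℝ) :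
    ℕ → EuclideanSpace ℝ (Fin N) → ℝ
  | 0 => u₀
  | m + 1 => fun y =>
      ⟪B (τ (m + 1)) y,
        gradient (fun y' => ∫ ω, kIter P Z B u₀ ℓ τ m (Z (ℓ m) (τ (m + 1)) y' (τ m) ω) ∂P) y⟫

/-- `(I^ℓ_{a,b})^{-1/2} (ζ_b - e^{(b-a)A} ζ_a - F_{a,b})`, for a path `ζ`. -/
def normIncr (A Q : Matrix (Fin N) (Fin N) ℝ) (f : ℝ → EuclideanSpace ℝ (Fin N)) (ℓ : TimeChange)
    (ζ : ℝ → EuclideanSpace ℝ (Fin N)) (a b : ℝ) : EuclideanSpace ℝ (Fin N) :=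
  act (invSqrtMat (covMat A Q ℓ a b)) (ζ b - act (expMat A (b - a)) (ζ a) - driftInt A f a b)

/-- For a path `ζ`, and times listed backwards,
`∑_{k=j+1}^{m} e^{(τ_j-τ_{k-1})A} [F_{τ_k,τ_{k-1}} + (I^{ℓ^{k-1}}_{τ_k,τ_{k-1}})^{1/2}
  (I^{ℓ^m}_{τ_k,τ_{k-1}})^{-1/2} (ζ_{τ_{k-1}} - e^{(τ_{k-1}-τ_k)A} ζ_{τ_k} - F_{τ_k,τ_{k-1}})]
  + e^{(τ_j-τ_m)A} ζ_{τ_m}`. -/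
def rescaledState (A Q : Matrix (Fin N) (Fin N) ℝ) (f : ℝ → EuclideanSpace ℝ (Fin N))
    (ℓ : ℕ → TimeChange) (τ : ℕ → ℝ) (m : ℕ) (ζ : ℝ → EuclideanSpace ℝ (Fin N)) (j : ℕ) :
    EuclideanSpace ℝ (Fin N) :=
  (∑ k ∈ Finset.Icc (j + 1) m,
    act (expMat A (τ j - τ (k - 1)))
      (driftInt A f (τ k) (τ (k - 1))
        + act (sqrtMat (covMat A Q (ℓ (k - 1)) (τ k) (τ (k - 1))))
            (normIncr A Q f (ℓ m) ζ (τ k) (τ (k - 1)))))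
  + act (expMat A (τ j - τ m)) (ζ (τ m))

end OUIter

end

/-! All matrices involved are diagonal, so each linear fact is checked one coordinate at a time.

An Ornstein-Uhlenbeck step from `a` to `b` started at `y` has the law of `e^{(b-a)A} y + F_{a,b} +
I^{1/2} g` with `g` standard Gaussian. Writing the deterministic part as a shift of `g` moves the
derivative in `y` from the merely measurable test function to the Gaussian density. The derivative
of `E[h]` in direction `v` is therefore the expectation of `h` times the weight `⟨I^{-1/2}
e^{(b-a)A} v, g⟩` (`hasFDerivAt_integral_affine_stdGaussian`). With `v = B(a, y)`, `kIter (m + 1)`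
is a weighted Gaussian integral of `kIter m`, again bounded and measurable, so the iteration
continues (`kIter_step`).

In these nested integrals the time change `ℓ^m` enters only through deterministic matrices. Any
independent standard Gaussian vectors may thus serve as integration variables, in particular the
normalised increments `G_j` of the single process driven by `ℓ^{i+1}`. The states `Y_j` follow the
transitions of `ℓ^{j}` with this borrowed noise. Since the process starts from the deterministic
point `x`, its value at `τ_{i+1}` is a.s. a function of the increment before `τ_{i+1}`, hence
independent of `G_1, …, G_{i+1}`. Integrating out `G_1`, then `G_2`, and so on, each against the
past that is independent of it, gives the conditional expectation (`integral_chain`,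
`condExp_chain`).

That the `G_j` are i.i.d. standard Gaussian (`IsOUProcess.normIncr_iid`) is proved without
stochastic integration. Partial integration along each path exhibits the stochastic convolution as a
limit of Riemann-Stieltjes sums; these are linear in Brownian increments, with explicit
characteristic functions, whose variances converge to the Lebesgue-Stieltjes integrals `I`. -/

noncomputable section

namespace OUIter

/-! ### Uniform grids and Riemann-Stieltjes sums -/

/-- The `l`-th point of the uniform grid of `[a, b]` with `n` cells. -/
def gridPt (a b : ℝ) (n l : ℕ) : ℝ := a + l * ((b - a) / n)

/-- The right endpoint of the grid cell that contains `r`. -/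
def gridCeil (a b : ℝ) (n : ℕ) (r : ℝ) : ℝ := gridPt a b n ⌈(r - a) / ((b - a) / n)⌉₊

lemma gridPt_zero (a b : ℝ) (n : ℕ) : gridPt a b n 0 = a := by simp [gridPt]

lemma gridPt_self {a b : ℝ} {n : ℕ} (hn : n ≠ 0) : gridPt a b n n = b := by
  have : (n : ℝ) ≠ 0 := by exact_mod_cast hn
  unfold gridPt; field_simp; ring

lemma gridPt_mono {a b : ℝ} (hab : a ≤ b) (n : ℕ) : Monotone (gridPt a b n) := by
  intro l m hlm
  have : (l : ℝ) ≤ m := by exact_mod_cast hlm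
  have h2 : 0 ≤ (b - a) / n := div_nonneg (by linarith) (by positivity)
  unfold gridPt; gcongr

lemma gridPt_mem {a b : ℝ} (hab : a ≤ b) {n l : ℕ} (hl : l ≤ n) : gridPt a b n l ∈ Icc a b := by
  refine ⟨by simpa [gridPt_zero] using gridPt_mono hab n (Nat.zero_le l), ?_⟩
  rcases eq_or_ne n 0 with rfl | hn
  · simp [gridPt, hab]
  · simpa [gridPt_self hn] using gridPt_mono hab n hl

lemma gridCeil_eq {a b : ℝ} (hab : a < b) {n l : ℕ} (hn : n ≠ 0) {r : ℝ}
    (hr : r ∈ Ioc (gridPt a b n l) (gridPt a b n (l + 1))) :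
    gridCeil a b n r = gridPt a b n (l + 1) := by
  have hd : 0 < (b - a) / n := div_pos (by linarith) (by positivity)
  unfold gridCeil
  congr 1
  rw [Nat.ceil_eq_iff (by omega)]
  simp only [gridPt, mem_Ioc] at hr
  constructor
  · rw [lt_div_iff₀ hd]; simp; linarith
  · rw [div_le_iff₀ hd]; linarith

lemma le_gridCeil {a b : ℝ} (hab : a < b) {n : ℕ} (hn : n ≠ 0) (r : ℝ) : r ≤ gridCeil a b n r := by
  have hd : 0 < (b - a) / n := div_pos (by linarith) (by positivity)
  have := Nat.le_ceil ((r - a) / ((b - a) / n))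
  rw [div_le_iff₀ hd] at this
  unfold gridCeil gridPt; linarith

lemma gridCeil_le {a b : ℝ} (hab : a < b) {n : ℕ} (hn : n ≠ 0) {r : ℝ} (hr : r ≤ b) :
    gridCeil a b n r ≤ b := by
  have hd : 0 < (b - a) / n := div_pos (by linarith) (by positivity)
  have h0 : (n : ℝ) ≠ 0 := by exact_mod_cast hn
  unfold gridCeil
  refine (gridPt_mem hab.le ?_).2
  rw [Nat.ceil_le, div_le_iff₀ hd]
  field_simp; linarith

lemma gridCeil_le_add {a b : ℝ} (hab : a < b) {n : ℕ} (hn : n ≠ 0) {r : ℝ} (hr : a ≤ r) :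
    gridCeil a b n r ≤ r + (b - a) / n := by
  have hd : 0 < (b - a) / n := div_pos (by linarith) (by positivity)
  have := (Nat.ceil_lt_add_one (div_nonneg (sub_nonneg.2 hr) hd.le)).le
  have h2 := mul_le_mul_of_nonneg_right this hd.le
  rw [add_mul, div_mul_cancel₀ _ hd.ne'] at h2
  unfold gridCeil gridPt; linarith

/-- Rounding up approaches `r` from the right without leaving `[a, b]`, so continuity from the right
is enough. -/
lemma tendsto_comp_gridCeil {F : Type*} [TopologicalSpace F] {a b r : ℝ} (hab : a < b)
    (hr : r ∈ Icc a b) {w : ℝ → F} (hw : ContinuousWithinAt w (Icc a b ∩ Ici r) r) :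
    Tendsto (fun n => w (gridCeil a b n r)) atTop (𝓝 (w r)) := by
  refine Tendsto.comp (y := 𝓝[Icc a b ∩ Ici r] r) hw ?_
  refine tendsto_nhdsWithin_iff.2 ⟨?_, ?_⟩
  · have h1 : Tendsto (fun n : ℕ => r + (b - a) / n) atTop (𝓝 (r + 0)) :=
      tendsto_const_nhds.add (tendsto_const_div_atTop_nhds_zero_nat _)
    rw [add_zero] at h1
    refine tendsto_of_tendsto_of_tendsto_of_le_of_le' tendsto_const_nhds h1 ?_ ?_
    · filter_upwards [eventually_ne_atTop 0] with n hn using le_gridCeil hab hn r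
    · filter_upwards [eventually_ne_atTop 0] with n hn using gridCeil_le_add hab hn hr.1
  · filter_upwards [eventually_ne_atTop 0] with n hn
    exact ⟨⟨hr.1.trans (le_gridCeil hab hn r), gridCeil_le hab hn hr.2⟩, le_gridCeil hab hn r⟩

/-- The composition factors through a natural number, so no regularity of `w` is needed. These step
functions are the measurable approximants of a right-continuous function. -/
lemma measurable_comp_gridCeil {F : Type*} [MeasurableSpace F] (a b : ℝ) (n : ℕ) (w : ℝ → F) :
    Measurable fun r => w (gridCeil a b n r) := by
  have : Measurable (fun l : ℕ => w (gridPt a b n l)) := measurable_from_top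
  exact this.comp (Nat.measurable_ceil.comp (by fun_prop))

/-- A function that is right-continuous on `[a, b]` is measurable there. -/
lemma aestronglyMeasurable_of_rightCont {F : Type*} [NormedAddCommGroup F]
    [SecondCountableTopology F] {a b : ℝ} {w : ℝ → F}
    (hw : ∀ r ∈ Icc a b, ContinuousWithinAt w (Icc a b ∩ Ici r) r) :
    AEStronglyMeasurable w (volume.restrict (Ioc a b)) := by
  borelize F
  rcases lt_or_ge a b with hab | hab
  · refine aestronglyMeasurable_of_tendsto_ae atTop
      (f := fun (n : ℕ) r => w (gridCeil a b n r))
      (fun n => (measurable_comp_gridCeil a b n w).aestronglyMeasurable) ?_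
    filter_upwards [ae_restrict_mem measurableSet_Ioc] with r hr
    exact tendsto_comp_gridCeil hab (Ioc_subset_Icc_self hr) (hw r (Ioc_subset_Icc_self hr))
  · simp [Ioc_eq_empty_of_le hab]

lemma intervalIntegrable_of_rightCont {F : Type*} [NormedAddCommGroup F]
    [SecondCountableTopology F] {a b : ℝ} (hab : a ≤ b) {w : ℝ → F}
    (hw : ∀ r ∈ Icc a b, ContinuousWithinAt w (Icc a b ∩ Ici r) r) {C : ℝ}
    (hC : ∀ r ∈ Icc a b, ‖w r‖ ≤ C) : IntervalIntegrable w volume a b := by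
  rw [intervalIntegrable_iff_integrableOn_Ioc_of_le hab]
  refine Integrable.of_bound (aestronglyMeasurable_of_rightCont hw) C ?_
  filter_upwards [ae_restrict_mem measurableSet_Ioc] with r hr
  exact hC r (Ioc_subset_Icc_self hr)

/-- Abel summation, with `v` centred at `v 0` so that the boundary term at `0` drops out. It moves
the differences from the rough factor to the smooth one. -/
lemma sum_mul_sub_eq (g v : ℕ → ℝ) (n : ℕ) :
    ∑ l ∈ Finset.range n, g l * (v (l + 1) - v l)
      = g n * (v n - v 0) - ∑ l ∈ Finset.range n, (g (l + 1) - g l) * (v (l + 1) - v 0) := by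
  induction n with
  | zero => simp
  | succ n ih => rw [Finset.sum_range_succ, Finset.sum_range_succ, ih]; ring

lemma hasDerivAt_exp_mul_sub (μ b r : ℝ) :
    HasDerivAt (fun r => Real.exp (-(μ * (b - r)))) (μ * Real.exp (-(μ * (b - r)))) r := by
  have h : HasDerivAt (fun r => -(μ * (b - r))) μ r := by
    have := ((hasDerivAt_id' r).sub_const b).const_mul μ
    rw [mul_one] at this
    exact this.congr_of_eventuallyEq (Eventually.of_forall fun r => by ring)
  simpa [mul_comm] using h.exp

lemma integral_mul_exp_mul_sub (μ b c d : ℝ) :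
    ∫ r in c..d, μ * Real.exp (-(μ * (b - r)))
      = Real.exp (-(μ * (b - d))) - Real.exp (-(μ * (b - c))) := by
  refine intervalIntegral.integral_eq_sub_of_hasDerivAt
    (fun r _ => hasDerivAt_exp_mul_sub μ b r) ?_
  exact (by fun_prop : Continuous fun r => μ * Real.exp (-(μ * (b - r)))).intervalIntegrable _ _

/-- Riemann-Stieltjes sums of an exponential against a right-continuous bounded function converge
to the integral obtained by partial integration. -/
lemma tendsto_sum_exp_mul_sub {a b : ℝ} (hab : a < b) (μ : ℝ) {w : ℝ → ℝ}
    (hw : ∀ r ∈ Icc a b, ContinuousWithinAt w (Icc a b ∩ Ici r) r) {C : ℝ}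
    (hC : ∀ r ∈ Icc a b, |w r| ≤ C) :
    Tendsto (fun n : ℕ => ∑ l ∈ Finset.range n,
      Real.exp (-(μ * (b - gridPt a b n l))) * (w (gridPt a b n (l + 1)) - w (gridPt a b n l)))
      atTop (𝓝 (w b - w a - ∫ r in a..b, μ * Real.exp (-(μ * (b - r))) * (w r - w a))) := by
  have hg : Continuous fun r => μ * Real.exp (-(μ * (b - r))) := by fun_prop
  have hbd : ∀ n : ℕ, n ≠ 0 → ∀ r ∈ Ioc a b, |w (gridCeil a b n r) - w a| ≤ 2 * C := by
    intro n hn r hr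
    have h1 := hC _ (⟨hr.1.le.trans (le_gridCeil hab hn r), gridCeil_le hab hn hr.2⟩ : gridCeil a b n r ∈ Icc a b)
    have h2 := hC a (left_mem_Icc.2 hab.le)
    calc _ ≤ |w (gridCeil a b n r)| + |w a| := abs_sub _ _
      _ ≤ _ := by linarith
  -- After summation by parts, the increment of the exponential over a cell is the integral of its
  -- derivative, and the factor at the right endpoint of the cell is `w ∘ gridCeil` there. The sum
  -- becomes an integral, to which dominated convergence applies.
  have key : ∀ n : ℕ, n ≠ 0 → ∑ l ∈ Finset.range n,
      Real.exp (-(μ * (b - gridPt a b n l))) * (w (gridPt a b n (l + 1)) - w (gridPt a b n l))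
      = w b - w a
        - ∫ r in a..b, μ * Real.exp (-(μ * (b - r))) * (w (gridCeil a b n r) - w a) := by
    intro n hn
    rw [sum_mul_sub_eq (fun l => Real.exp (-(μ * (b - gridPt a b n l))))
      (fun l => w (gridPt a b n l))]
    have hcell : ∀ l, ∀ r ∈ uIoc (gridPt a b n l) (gridPt a b n (l + 1)),
        μ * Real.exp (-(μ * (b - r))) * (w (gridCeil a b n r) - w a)
          = μ * Real.exp (-(μ * (b - r))) * (w (gridPt a b n (l + 1)) - w a) := by
      intro l r hr
      rw [uIoc_of_le (gridPt_mono hab.le n l.le_succ)] at hr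
      rw [gridCeil_eq hab hn hr]
    have h := intervalIntegral.sum_integral_adjacent_intervals (n := n) (a := gridPt a b n)
      (μ := volume)
      (f := fun r => μ * Real.exp (-(μ * (b - r))) * (w (gridCeil a b n r) - w a)) ?_
    · rw [gridPt_zero, gridPt_self hn] at h
      rw [← h, gridPt_self hn, gridPt_zero]
      congr 1
      · simp
      · refine Finset.sum_congr rfl fun l _ => ?_
        rw [intervalIntegral.integral_congr_ae (Eventually.of_forall (hcell l)),
          intervalIntegral.integral_mul_const, integral_mul_exp_mul_sub]
    · intro l _
      refine IntervalIntegrable.congr (fun r hr => (hcell l r hr).symm) ?_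
      exact (hg.mul continuous_const).intervalIntegrable _ _
  have lim : Tendsto (fun n : ℕ => ∫ r in a..b,
      μ * Real.exp (-(μ * (b - r))) * (w (gridCeil a b n r) - w a)) atTop
      (𝓝 (∫ r in a..b, μ * Real.exp (-(μ * (b - r))) * (w r - w a))) := by
    refine intervalIntegral.tendsto_integral_filter_of_dominated_convergence
      (fun r => |μ * Real.exp (-(μ * (b - r)))| * (2 * C)) ?_ ?_ ?_ ?_
    · refine Eventually.of_forall fun n => ?_
      exact (hg.measurable.mul ((measurable_comp_gridCeil a b n w).sub_const _)).aestronglyMeasurable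
    · filter_upwards [eventually_ne_atTop 0] with n hn
      refine Eventually.of_forall fun r hr => ?_
      rw [uIoc_of_le hab.le] at hr
      rw [norm_mul, Real.norm_eq_abs, Real.norm_eq_abs]
      exact mul_le_mul_of_nonneg_left (hbd n hn r hr) (abs_nonneg _)
    · exact (hg.abs.mul continuous_const).intervalIntegrable _ _
    · refine Eventually.of_forall fun r hr => ?_
      rw [uIoc_of_le hab.le] at hr
      have hr' := Ioc_subset_Icc_self hr
      exact ((tendsto_comp_gridCeil hab hr' (hw r hr')).sub_const _).const_mul _
  refine (tendsto_const_nhds.sub lim).congr' ?_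
  filter_upwards [eventually_ne_atTop 0] with n hn using (key n hn).symm

/-- Riemann-Stieltjes sums of an exponential against a monotone right-continuous function converge
to the Lebesgue-Stieltjes integral. -/
lemma tendsto_sum_exp_mul_stieltjes {a b : ℝ} (hab : a < b) {μ : ℝ} (hμ : 0 ≤ μ)
    (L : StieltjesFunction ℝ) :
    Tendsto (fun n : ℕ => ∑ l ∈ Finset.range n,
      Real.exp (-(μ * (b - gridPt a b n l))) * (L (gridPt a b n (l + 1)) - L (gridPt a b n l)))
      atTop (𝓝 (∫ r in Ioc a b, Real.exp (-(μ * (b - r))) ∂L.measure)) := by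
  have hg : Continuous fun r => Real.exp (-(μ * (b - r))) := by fun_prop
  have hint : ∀ c d, IntervalIntegrable (fun r => Real.exp (-(μ * (b - r)))) L.measure c d :=
    fun c d => hg.intervalIntegrable _ _
  have hmeas : ∀ c d, c ≤ d → L.measure.real (Ioc c d) = L d - L c := by
    intro c d hcd
    rw [measureReal_def, L.measure_Ioc, ENNReal.toReal_ofReal (sub_nonneg.2 (L.mono hcd))]
  rw [← intervalIntegral.integral_of_le hab.le]
  refine tendsto_iff_norm_sub_tendsto_zero.2 ?_
  have h0 : Tendsto (fun n : ℕ => (μ * (L b - L a) * (b - a)) / n) atTop (𝓝 0) :=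
    tendsto_const_div_atTop_nhds_zero_nat _
  refine tendsto_of_tendsto_of_tendsto_of_le_of_le' tendsto_const_nhds h0
    (Eventually.of_forall fun n => norm_nonneg _) ?_
  filter_upwards [eventually_ne_atTop 0] with n hn
  have hsum := intervalIntegral.sum_integral_adjacent_intervals (n := n) (a := gridPt a b n)
    (μ := L.measure) (f := fun r => Real.exp (-(μ * (b - r)))) (fun l _ => hint _ _)
  rw [gridPt_zero, gridPt_self hn] at hsum
  rw [← hsum, ← Finset.sum_sub_distrib]
  -- The deviation from the left endpoint value is `e^{-μ(b-r)} (1 - e^{-μ(r-left)})`; the first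
  -- factor is at most `1` and the second at most `μ` times the mesh. Summing telescopes the masses
  -- of the cells to `L b - L a`.
  have hcell : ∀ l ∈ Finset.range n,
      ‖Real.exp (-(μ * (b - gridPt a b n l))) * (L (gridPt a b n (l + 1)) - L (gridPt a b n l))
        - ∫ r in gridPt a b n l..gridPt a b n (l + 1), Real.exp (-(μ * (b - r))) ∂L.measure‖
      ≤ μ * ((b - a) / n) * (L (gridPt a b n (l + 1)) - L (gridPt a b n l)) := by
    intro l hl
    have hle := gridPt_mono hab.le n l.le_succ
    have hb : gridPt a b n (l + 1) ≤ b := (gridPt_mem hab.le (Finset.mem_range.1 hl)).2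
    have hfin : L.measure (Ioc (gridPt a b n l) (gridPt a b n (l + 1))) < ⊤ := by
      rw [L.measure_Ioc]; exact ENNReal.ofReal_lt_top
    rw [intervalIntegral.integral_of_le hle, norm_sub_rev, ← hmeas _ _ hle]
    have hc : Real.exp (-(μ * (b - gridPt a b n l)))
        * L.measure.real (Ioc (gridPt a b n l) (gridPt a b n (l + 1)))
        = ∫ _ in Ioc (gridPt a b n l) (gridPt a b n (l + 1)),
          Real.exp (-(μ * (b - gridPt a b n l))) ∂L.measure := by
      rw [setIntegral_const, smul_eq_mul, mul_comm]
    rw [hc, ← integral_sub ((intervalIntegrable_iff_integrableOn_Ioc_of_le hle).1 (hint _ _))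
      (integrableOn_const hfin.ne)]
    refine norm_setIntegral_le_of_norm_le_const hfin fun r hr => ?_
    have h1 : Real.exp (-(μ * (b - gridPt a b n l))) ≤ Real.exp (-(μ * (b - r))) := by
      apply Real.exp_le_exp.2
      nlinarith [hr.1]
    rw [Real.norm_eq_abs, abs_of_nonneg (sub_nonneg.2 h1)]
    have h2 : -(μ * (b - gridPt a b n l)) = -(μ * (b - r)) + -(μ * (r - gridPt a b n l)) := by ring
    have h3 := Real.add_one_le_exp (-(μ * (r - gridPt a b n l)))
    have h4 : Real.exp (-(μ * (b - r))) ≤ 1 := by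
      apply Real.exp_le_one_iff.2
      nlinarith [hr.2]
    have h5 : r - gridPt a b n l ≤ (b - a) / n := by
      have := hr.2
      simp only [gridPt] at this ⊢
      push_cast at this
      linarith
    have h6 := hr.1
    rw [h2, Real.exp_add]
    have h7 : μ * (r - gridPt a b n l) ≤ μ * ((b - a) / n) := by gcongr
    have h8 : 0 ≤ μ * (r - gridPt a b n l) := mul_nonneg hμ (by linarith)
    have h9 := Real.exp_pos (-(μ * (b - r)))
    nlinarith
  refine (norm_sum_le _ _).trans ((Finset.sum_le_sum hcell).trans (le_of_eq ?_))
  rw [← Finset.mul_sum, Finset.sum_range_sub (fun l => L (gridPt a b n l)), gridPt_zero,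
    gridPt_self hn]
  ring

/-! ### Pathwise solution of the linear equation -/

/-- The increment of a scalar linear equation with additive driver. -/
lemma linear_eqn_increment {a₀ a b lam x : ℝ} (ha : a₀ ≤ a) (hab : a ≤ b) {z f w : ℝ → ℝ}
    (hz : ∀ r ∈ Icc a₀ b, ContinuousWithinAt z (Icc a₀ b ∩ Ici r) r) {C : ℝ}
    (hC : ∀ r ∈ Icc a₀ b, |z r| ≤ C) (hf : ContinuousOn f (Icc a₀ b))
    (h : ∀ r ∈ Icc a₀ b, z r = x + (∫ u in a₀..r, (-(lam * z u) + f u)) + (w r - w a₀)) :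
    z b - Real.exp (-(lam * (b - a))) * z a - (∫ r in a..b, Real.exp (-(lam * (b - r))) * f r)
      = w b - w a - ∫ r in a..b, lam * Real.exp (-(lam * (b - r))) * (w r - w a) := by
  have h0b : a₀ ≤ b := ha.trans hab
  have hgr : ∀ r ∈ Icc a₀ b,
      ContinuousWithinAt (fun u => -(lam * z u) + f u) (Icc a₀ b ∩ Ici r) r := fun r hr =>
    ((hz r hr).const_mul lam).neg.add ((hf r hr).mono inter_subset_left)
  have hzint : IntervalIntegrable z volume a₀ b := intervalIntegrable_of_rightCont h0b hz hC
  have hfint : IntervalIntegrable f volume a₀ b :=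
    (hf.mono (by rw [uIcc_of_le h0b])).intervalIntegrable
  have hgint : IntervalIntegrable (fun u => -(lam * z u) + f u) volume a₀ b :=
    (hzint.const_mul lam).neg.add hfint
  have hsub : ∀ {c d}, c ∈ Icc a₀ b → d ∈ Icc a₀ b → uIcc c d ⊆ uIcc a₀ b := by
    intro c d hc hd
    exact uIcc_subset_uIcc (by rwa [uIcc_of_le h0b]) (by rwa [uIcc_of_le h0b])
  have ham : a ∈ Icc a₀ b := ⟨ha, hab⟩
  have hbm : b ∈ Icc a₀ b := ⟨h0b, le_rfl⟩
  have h0m : a₀ ∈ Icc a₀ b := ⟨le_rfl, h0b⟩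
  set V : ℝ → ℝ := fun r => ∫ u in a..r, (-(lam * z u) + f u) with hV
  have hVz : ∀ r ∈ Icc a b, z r = z a + V r + (w r - w a) := by
    intro r hr
    have hrm : r ∈ Icc a₀ b := ⟨ha.trans hr.1, hr.2⟩
    rw [h r hrm, h a ham, hV,
      ← intervalIntegral.integral_add_adjacent_intervals (hgint.mono_set (hsub h0m ham))
        (hgint.mono_set (hsub ham hrm))]
    ring
  have hVcont : ContinuousOn V (Icc a b) := by
    rw [← uIcc_of_le hab]
    refine intervalIntegral.continuousOn_primitive_interval ?_
    have := (intervalIntegrable_iff_integrableOn_Icc_of_le hab).1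
      (hgint.mono_set (hsub ham hbm))
    rwa [uIcc_of_le hab]
  -- No regularity of `w` is assumed; its increments inherit integrability from `z` and the
  -- continuous `V` through the equation.
  have hwz : ∀ r ∈ Icc a b, w r - w a = z r - z a - V r := fun r hr => by
    rw [hVz r hr]; ring
  -- Variation of constants applied to `V` rather than `z`, since `z` may jump while `V` is
  -- continuous with a right derivative everywhere inside. Substituting `z - V = z a + (w r - w a)`
  -- removes `z r` from the derivative.
  have hderiv : ∀ r ∈ Ioo a b, HasDerivWithinAt
      (fun r => Real.exp (-(lam * (b - r))) * V r)
      (Real.exp (-(lam * (b - r))) * (-(lam * z a) - lam * (w r - w a) + f r)) (Ioi r) r := by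
    intro r hr
    have hrm : r ∈ Icc a₀ b := ⟨ha.trans hr.1.le, hr.2.le⟩
    have h1 : HasDerivWithinAt V (-(lam * z r) + f r) (Ioi r) r := by
      refine HasDerivWithinAt.mono ?_ Ioi_subset_Ici_self
      refine intervalIntegral.integral_hasDerivWithinAt_right (hgint.mono_set (hsub ham hrm))
        (t := Ioi r) ?_ ?_
      · refine ⟨Ioc a₀ b, mem_nhdsWithin_of_mem_nhds
          (mem_of_superset (Ioo_mem_nhds (ha.trans_lt hr.1) hr.2) Ioo_subset_Ioc_self), ?_⟩
        exact aestronglyMeasurable_of_rightCont hgr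
      · refine (hgr r hrm).mono_of_mem_nhdsWithin ?_
        refine inter_mem ?_ (mem_of_superset self_mem_nhdsWithin Ioi_subset_Ici_self)
        exact mem_nhdsWithin_of_mem_nhds (Icc_mem_nhds (ha.trans_lt hr.1) hr.2)
    refine ((hasDerivAt_exp_mul_sub lam b r).hasDerivWithinAt.mul h1).congr_deriv ?_
    rw [hwz r (Ioo_subset_Icc_self hr)]
    ring
  have hexp : Continuous fun r => Real.exp (-(lam * (b - r))) := by fun_prop
  have hwint : IntervalIntegrable (fun r => w r - w a) volume a b := by
    have h1 : IntervalIntegrable (fun r => z r - z a - V r) volume a b :=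
      ((hzint.mono_set (hsub ham hbm)).sub intervalIntegrable_const).sub
        (hVcont.mono (by rw [uIcc_of_le hab])).intervalIntegrable
    refine h1.congr fun r hr => ?_
    rw [uIoc_of_le hab] at hr
    exact (hwz r (Ioc_subset_Icc_self hr)).symm
  have hwint' : IntervalIntegrable
      (fun r => lam * Real.exp (-(lam * (b - r))) * (w r - w a)) volume a b :=
    hwint.continuousOn_mul (by fun_prop)
  have hfint' : IntervalIntegrable (fun r => Real.exp (-(lam * (b - r))) * f r) volume a b :=
    (hfint.mono_set (hsub ham hbm)).continuousOn_mul (by fun_prop)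
  have hcint : IntervalIntegrable (fun r => lam * Real.exp (-(lam * (b - r))) * z a) volume a b :=
    (by fun_prop : Continuous fun r => lam * Real.exp (-(lam * (b - r))) * z a).intervalIntegrable
      _ _
  have hsplit : (fun r => Real.exp (-(lam * (b - r))) * (-(lam * z a) - lam * (w r - w a) + f r))
      = fun r => Real.exp (-(lam * (b - r))) * f r
        - lam * Real.exp (-(lam * (b - r))) * (w r - w a)
        - lam * Real.exp (-(lam * (b - r))) * z a := by
    ext r; ring
  have key := intervalIntegral.integral_eq_sub_of_hasDeriv_right_of_le hab
    (hexp.continuousOn.mul hVcont) hderiv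
    (by rw [hsplit]; exact (hfint'.sub hwint').sub hcint)
  rw [hsplit, intervalIntegral.integral_sub (hfint'.sub hwint') hcint,
    intervalIntegral.integral_sub hfint' hwint', intervalIntegral.integral_mul_const,
    integral_mul_exp_mul_sub] at key
  have hVa : V a = 0 := by simp [hV]
  have hb := hVz b ⟨hab, le_rfl⟩
  simp only [Pi.mul_apply, hVa, sub_self, mul_zero, neg_zero, Real.exp_zero, one_mul, sub_zero] at key
  linarith

/-- A càdlàg function is bounded on a compact interval. -/
lemma IsCadlagOn.exists_bound {F : Type*} [NormedAddCommGroup F] {g : ℝ → F} {a b : ℝ}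
    (hg : IsCadlagOn g (Icc a b)) : ∃ C, ∀ r ∈ Icc a b, ‖g r‖ ≤ C := by
  refine isCompact_Icc.induction_on (p := fun s => ∃ C, ∀ r ∈ s, ‖g r‖ ≤ C) ⟨0, by simp⟩
    (fun s t hst ⟨C, hC⟩ => ⟨C, fun r hr => hC r (hst hr)⟩)
    (fun s t ⟨C, hC⟩ ⟨D, hD⟩ => ⟨max C D, fun r hr => hr.elim
      (fun h => (hC r h).trans (le_max_left _ _)) (fun h => (hD r h).trans (le_max_right _ _))⟩)
    fun r hr => ?_
  obtain ⟨hright, l, hl⟩ := hg r hr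
  have h1 : ∀ᶠ u in 𝓝[Icc a b ∩ Ici r] r, ‖g u‖ < ‖g r‖ + 1 :=
    hright.norm.eventually (gt_mem_nhds (lt_add_one _))
  have h2 : ∀ᶠ u in 𝓝[Icc a b ∩ Iio r] r, ‖g u‖ < ‖l‖ + 1 :=
    hl.norm.eventually (gt_mem_nhds (lt_add_one _))
  have heq : Icc a b = (Icc a b ∩ Ici r) ∪ (Icc a b ∩ Iio r) := by
    rw [← inter_union_distrib_left, union_comm, Iio_union_Ici, inter_univ]
  refine ⟨{u | ‖g u‖ ≤ max (‖g r‖ + 1) (‖l‖ + 1)}, ?_, _, fun u hu => hu⟩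
  rw [heq, nhdsWithin_union]
  exact ⟨h1.mono fun u hu => hu.le.trans (le_max_left _ _),
    h2.mono fun u hu => hu.le.trans (le_max_right _ _)⟩

/-! ### Diagonal matrices and the recursion for the rescaled states -/

section Matrices

variable {N : ℕ}

lemma act_diagonal_apply (d : Fin N → ℝ) (x : EuclideanSpace ℝ (Fin N)) (p : Fin N) :
    act (Matrix.diagonal d) x p = d p * x p := by
  simp [act, Matrix.mulVec_diagonal]

/-- The action of a matrix as a continuous linear map. -/
def actL (M : Matrix (Fin N) (Fin N) ℝ) :
    EuclideanSpace ℝ (Fin N) →L[ℝ] EuclideanSpace ℝ (Fin N) :=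
  Matrix.toEuclideanCLM (𝕜 := ℝ) M

lemma actL_apply (M : Matrix (Fin N) (Fin N) ℝ) (x : EuclideanSpace ℝ (Fin N)) :
    actL M x = act M x := rfl

lemma act_add (M : Matrix (Fin N) (Fin N) ℝ) (x y : EuclideanSpace ℝ (Fin N)) :
    act M (x + y) = act M x + act M y := (actL M).map_add x y

lemma measurable_act (M : Matrix (Fin N) (Fin N) ℝ) : Measurable (act M) :=
  (actL M).continuous.measurable

lemma expMat_neg_diagonal (lam : Fin N → ℝ) (r : ℝ) :
    expMat (-Matrix.diagonal lam) r = Matrix.diagonal fun p => Real.exp (-(lam p * r)) := by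
  have : r • -Matrix.diagonal lam = Matrix.diagonal fun p => -(lam p * r) := by
    ext p q
    rcases eq_or_ne p q with rfl | hpq
    · simp [mul_comm]
    · simp [Matrix.diagonal_apply_ne _ hpq]
  rw [expMat, this, Matrix.exp_diagonal]
  congr 1
  ext p
  rw [Pi.coe_exp, Real.exp_eq_exp_ℝ]

lemma sqrtMat_diagonal {d : Fin N → ℝ} (hd : ∀ p, 0 ≤ d p) :
    sqrtMat (Matrix.diagonal d) = Matrix.diagonal fun p => √(d p) := by
  refine CFC.sqrt_unique ?_ ?_
  · rw [Matrix.diagonal_mul_diagonal]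
    congr 1; ext p; exact Real.mul_self_sqrt (hd p)
  · rw [Matrix.nonneg_iff_posSemidef]
    exact Matrix.PosSemidef.diagonal fun p => Real.sqrt_nonneg _

lemma invSqrtMat_diagonal {d : Fin N → ℝ} (hd : ∀ p, 0 < d p) :
    invSqrtMat (Matrix.diagonal d) = Matrix.diagonal fun p => (√(d p))⁻¹ := by
  rw [invSqrtMat, sqrtMat_diagonal fun p => (hd p).le]
  refine Matrix.inv_eq_left_inv ?_
  rw [Matrix.diagonal_mul_diagonal, ← Matrix.diagonal_one]
  congr 1; ext p
  exact inv_mul_cancel₀ (Real.sqrt_pos.2 (hd p)).ne'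

/-- The diagonal of `covMat`, for diagonal `A` and `Q`. -/
def covDiag (lam sig : Fin N → ℝ) (ℓ : TimeChange) (a b : ℝ) (p : Fin N) : ℝ :=
  sig p ^ 2 * ∫ r in Ioc a b, Real.exp (-(2 * lam p * (b - r))) ∂ℓ.stieltjes.measure

lemma covMat_eq_diagonal (lam sig : Fin N → ℝ) (ℓ : TimeChange) (a b : ℝ) :
    covMat (-Matrix.diagonal lam) (Matrix.diagonal fun p => sig p ^ 2) ℓ a b
      = Matrix.diagonal (covDiag lam sig ℓ a b) := by
  ext p q
  simp only [covMat, Matrix.of_apply, expMat_neg_diagonal, Matrix.diagonal_mul_diagonal]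
  rcases eq_or_ne p q with rfl | hpq
  · simp only [Matrix.diagonal_apply_eq, covDiag]
    rw [← integral_const_mul]
    refine integral_congr_ae (Eventually.of_forall fun r => ?_)
    simp only
    rw [mul_comm, ← mul_assoc (lam p), mul_comm (lam p) 2]
  · simp [Matrix.diagonal_apply_ne _ hpq]

lemma TimeChange.nonneg (ℓ : TimeChange) (r : ℝ≥0) : 0 ≤ ℓ.toFun r := by
  rw [← ℓ.map_zero]
  exact ℓ.strictMono.monotone zero_le

/-- A strictly increasing `ℓ` gives positive mass to `(a, b]`, and the integrand is positive. This
is what makes `I^{-1/2}` a genuine inverse. -/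
lemma covDiag_pos {lam sig : Fin N → ℝ} (hsig : ∀ p, 0 < sig p ^ 2)
    (ℓ : TimeChange) {a b : ℝ} (ha : 0 ≤ a) (hab : a < b) (p : Fin N) :
    0 < covDiag lam sig ℓ a b p := by
  refine mul_pos (hsig p) ?_
  have hc : Continuous fun r => Real.exp (-(2 * lam p * (b - r))) := by fun_prop
  have hint : IntegrableOn (fun r => Real.exp (-(2 * lam p * (b - r)))) (Ioc a b)
      ℓ.stieltjes.measure :=
    (intervalIntegrable_iff_integrableOn_Ioc_of_le hab.le).1 (hc.intervalIntegrable _ _)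
  rw [setIntegral_pos_iff_support_of_nonneg_ae
    (Eventually.of_forall fun r => (Real.exp_pos _).le) hint]
  have : Function.support (fun r => Real.exp (-(2 * lam p * (b - r)))) = univ := by
    ext r; simp [(Real.exp_pos _).ne']
  rw [this, univ_inter, ℓ.stieltjes.measure_Ioc, ENNReal.ofReal_pos, sub_pos]
  exact ℓ.strictMono ((Real.toNNReal_lt_toNNReal_iff (ha.trans_lt hab)).2 hab)

lemma driftInt_apply (lam : Fin N → ℝ) {f : ℝ → EuclideanSpace ℝ (Fin N)} {a b : ℝ} (hab : a ≤ b)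
    (hf : ContinuousOn f (Icc a b)) (p : Fin N) :
    driftInt (-Matrix.diagonal lam) f a b p
      = ∫ r in a..b, Real.exp (-(lam p * (b - r))) * f r p := by
  have hint : IntervalIntegrable (fun r => act (expMat (-Matrix.diagonal lam) (b - r)) (f r))
      volume a b := by
    refine ContinuousOn.intervalIntegrable ?_
    rw [uIcc_of_le hab]
    have h : ContinuousOn (fun r => WithLp.toLp 2
        fun q => Real.exp (-(lam q * (b - r))) * f r q) (Icc a b) := by
      refine (PiLp.continuous_toLp 2 _).comp_continuousOn (continuousOn_pi.2 fun q => ?_)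
      refine ContinuousOn.mul (by fun_prop) ?_
      exact (EuclideanSpace.proj (𝕜 := ℝ) q).continuous.comp_continuousOn hf
    refine h.congr fun r _ => ?_
    ext q
    simp only [expMat_neg_diagonal, act_diagonal_apply]
  have h := (EuclideanSpace.proj (𝕜 := ℝ) p).intervalIntegral_comp_comm hint
  refine h.symm.trans ?_
  simp only [expMat_neg_diagonal, PiLp.proj_apply, act_diagonal_apply]

lemma act_expMat_add (lam : Fin N → ℝ) (r u : ℝ) (x : EuclideanSpace ℝ (Fin N)) :
    act (expMat (-Matrix.diagonal lam) r) (act (expMat (-Matrix.diagonal lam) u) x)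
      = act (expMat (-Matrix.diagonal lam) (r + u)) x := by
  ext p
  simp only [expMat_neg_diagonal, act_diagonal_apply]
  rw [← mul_assoc, ← Real.exp_add]
  congr 2; ring

lemma act_expMat_zero (lam : Fin N → ℝ) (x : EuclideanSpace ℝ (Fin N)) :
    act (expMat (-Matrix.diagonal lam) 0) x = x := by
  ext p
  rw [expMat_neg_diagonal, act_diagonal_apply, mul_zero, neg_zero, Real.exp_zero, one_mul]

lemma act_sqrtMat_act_invSqrtMat {M : Matrix (Fin N) (Fin N) ℝ} {d : Fin N → ℝ}
    (hM : M = Matrix.diagonal d) (hd : ∀ p, 0 < d p) (x : EuclideanSpace ℝ (Fin N)) :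
    act (sqrtMat M) (act (invSqrtMat M) x) = x := by
  subst hM
  ext p
  rw [sqrtMat_diagonal fun p => (hd p).le, invSqrtMat_diagonal hd, act_diagonal_apply,
    act_diagonal_apply, mul_inv_cancel_left₀ (Real.sqrt_pos.2 (hd p)).ne']

lemma rescaledState_self (lam : Fin N → ℝ) (Q : Matrix (Fin N) (Fin N) ℝ)
    (f : ℝ → EuclideanSpace ℝ (Fin N)) (ℓ : ℕ → TimeChange) (τ : ℕ → ℝ) (m : ℕ)
    (ζ : ℝ → EuclideanSpace ℝ (Fin N)) :
    rescaledState (-Matrix.diagonal lam) Q f ℓ τ m ζ m = ζ (τ m) := by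
  rw [rescaledState, Finset.Icc_eq_empty (by omega), Finset.sum_empty, zero_add, sub_self,
    act_expMat_zero]

/-- The term `k = j + 1` of the sum carries the propagator `e^{0·A}` and splits off; the semigroup
property pulls `e^{(τ_j-τ_{j+1})A}` out of the rest. Thus the states form a Markov-type chain: noise
normalised under `ℓ m` is fed into the transition with the covariance of `ℓ j`. -/
lemma rescaledState_succ (lam : Fin N → ℝ) (Q : Matrix (Fin N) (Fin N) ℝ)
    (f : ℝ → EuclideanSpace ℝ (Fin N)) (ℓ : ℕ → TimeChange) (τ : ℕ → ℝ) {m j : ℕ} (hj : j < m)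
    (ζ : ℝ → EuclideanSpace ℝ (Fin N)) :
    rescaledState (-Matrix.diagonal lam) Q f ℓ τ m ζ j
      = act (expMat (-Matrix.diagonal lam) (τ j - τ (j + 1)))
          (rescaledState (-Matrix.diagonal lam) Q f ℓ τ m ζ (j + 1))
        + driftInt (-Matrix.diagonal lam) f (τ (j + 1)) (τ j)
        + act (sqrtMat (covMat (-Matrix.diagonal lam) Q (ℓ j) (τ (j + 1)) (τ j)))
            (normIncr (-Matrix.diagonal lam) Q f (ℓ m) ζ (τ (j + 1)) (τ j)) := by
  have hsum : ∀ (s : Finset ℕ) (g : ℕ → EuclideanSpace ℝ (Fin N)) (M : Matrix (Fin N) (Fin N) ℝ),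
      act M (∑ k ∈ s, g k) = ∑ k ∈ s, act M (g k) := fun s g M => map_sum (actL M) g s
  rw [rescaledState, rescaledState, ← Finset.insert_Icc_add_one_left_eq_Icc (by omega : j + 1 ≤ m),
    Finset.sum_insert (by simp), act_add _ (∑ k ∈ _, _), hsum]
  simp only [act_expMat_add, add_tsub_cancel_right, sub_self, act_expMat_zero, sub_add_sub_cancel]
  abel

end Matrices

/-! ### Gaussian density and differentiation under the Gaussian integral -/

section Smoothing

/-- The constant that normalises the Gaussian density. -/
def gaussConst (E : Type*) [NormedAddCommGroup E] [InnerProductSpace ℝ E] : ℝ :=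
  ((2 * Real.pi) ^ ((Module.finrank ℝ E : ℝ) / 2))⁻¹

lemma gaussConst_pos {E : Type*} [NormedAddCommGroup E] [InnerProductSpace ℝ E] :
    0 < gaussConst E := by unfold gaussConst; positivity

variable {E : Type*} [NormedAddCommGroup E] [InnerProductSpace ℝ E] [FiniteDimensional ℝ E]
  [MeasurableSpace E] [BorelSpace E]

lemma integrable_exp_neg_mul_sq_norm {c : ℝ} (hc : 0 < c) :
    Integrable fun z : E => Real.exp (-c * ‖z‖ ^ 2) := by
  have h := (GaussianFourier.integrable_cexp_neg_mul_sq_norm_add (V := E) (b := (c : ℂ))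
    (by simpa using hc) 0 0).norm
  refine h.congr (Eventually.of_forall fun z => ?_)
  simp only [zero_mul, add_zero, Complex.norm_exp]
  norm_cast

/-- Both sides have characteristic function `e^{-‖t‖²/2}`, by the Gaussian Fourier integral. The
density is needed because the translation derivative must fall on it. -/
lemma stdGaussian_eq_withDensity : stdGaussian E
    = (volume : Measure E).withDensity
      fun z => ENNReal.ofReal (gaussConst E * Real.exp (-(1 / 2) * ‖z‖ ^ 2)) := by
  have hint : Integrable fun z : E => gaussConst E * Real.exp (-(1 / 2) * ‖z‖ ^ 2) :=
    (integrable_exp_neg_mul_sq_norm (by norm_num)).const_mul _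
  have : IsFiniteMeasure ((volume : Measure E).withDensity
      fun z => ENNReal.ofReal (gaussConst E * Real.exp (-(1 / 2) * ‖z‖ ^ 2))) :=
    isFiniteMeasure_withDensity_ofReal hint.2
  refine Measure.ext_of_charFun ?_
  ext t
  rw [charFun_stdGaussian, charFun_apply,
    integral_withDensity_eq_integral_toReal_smul (by fun_prop)
      (Eventually.of_forall fun _ => ENNReal.ofReal_lt_top)]
  have h := GaussianFourier.integral_cexp_neg_mul_sq_norm_add (V := E) (b := (1 / 2 : ℂ))
    (by norm_num) Complex.I t
  have hfun : (fun z : E => (ENNReal.ofReal (gaussConst E * Real.exp (-(1 / 2) * ‖z‖ ^ 2))).toReal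
        • Complex.exp ((⟪z, t⟫ : ℝ) * Complex.I))
      = fun z : E => (gaussConst E : ℂ)
          * Complex.exp (-(1 / 2) * (‖z‖ : ℂ) ^ 2 + Complex.I * (⟪t, z⟫ : ℝ)) := by
    ext z
    rw [ENNReal.toReal_ofReal (by have := gaussConst_pos (E := E); positivity), Complex.exp_add,
      real_inner_comm, mul_comm Complex.I, Complex.real_smul]
    push_cast
    ring
  rw [hfun, integral_const_mul, h, ← mul_assoc]
  have hc : (gaussConst E : ℂ) * ((Real.pi : ℂ) / (1 / 2)) ^ ((Module.finrank ℝ E : ℂ) / 2) = 1 := by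
    have h2 : ((Real.pi : ℂ) / (1 / 2)) = ((2 * Real.pi : ℝ) : ℂ) := by push_cast; ring
    have h3 : ((Module.finrank ℝ E : ℂ) / 2) = (((Module.finrank ℝ E : ℝ) / 2 : ℝ) : ℂ) := by
      push_cast; ring
    rw [h2, h3, ← Complex.ofReal_cpow (by positivity), ← Complex.ofReal_mul, gaussConst,
      inv_mul_cancel₀ (by positivity), Complex.ofReal_one]
  rw [hc, one_mul, Complex.I_sq]
  congr 1
  ring

lemma integral_stdGaussian {F : Type*} [NormedAddCommGroup F] [NormedSpace ℝ F] (h : E → F) :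
    ∫ z, h z ∂(stdGaussian E)
      = ∫ z, (gaussConst E * Real.exp (-(1 / 2) * ‖z‖ ^ 2)) • h z := by
  rw [stdGaussian_eq_withDensity,
    integral_withDensity_eq_integral_toReal_smul (by fun_prop)
      (Eventually.of_forall fun _ => ENNReal.ofReal_lt_top)]
  refine integral_congr_ae (Eventually.of_forall fun z => ?_)
  simp only
  rw [ENNReal.toReal_ofReal (by have := gaussConst_pos (E := E); positivity)]

/-- Differentiation of the convolution with a standard Gaussian measure. -/
lemma hasFDerivAt_integral_add_stdGaussian {h : E → ℝ} (hm : Measurable h) {C : ℝ}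
    (hC : ∀ z, |h z| ≤ C) (v : E) :
    HasFDerivAt (fun v => ∫ g, h (v + g) ∂(stdGaussian E))
      (∫ g, h (v + g) • innerSL ℝ g ∂(stdGaussian E)) v := by
  set κ := gaussConst E with hκ
  have hκ0 : 0 < κ := gaussConst_pos
  have hC0 : 0 ≤ C := (abs_nonneg _).trans (hC 0)
  -- Translation invariance of Lebesgue measure moves `v` out of `h`, which need not be continuous,
  -- into the smooth density.
  have h1 : (fun v => ∫ g, h (v + g) ∂(stdGaussian E))
      = fun v => ∫ z, (κ * Real.exp (-(1 / 2) * ‖z - v‖ ^ 2)) * h z := by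
    ext v
    rw [integral_stdGaussian, ← integral_add_left_eq_self
      (fun z => (κ * Real.exp (-(1 / 2) * ‖z - v‖ ^ 2)) * h z) v]
    simp [hκ]
  have h2 : (∫ g, h (v + g) • innerSL ℝ g ∂(stdGaussian E))
      = ∫ z, ((κ * Real.exp (-(1 / 2) * ‖z - v‖ ^ 2)) * h z) • innerSL ℝ (z - v) := by
    rw [integral_stdGaussian, ← integral_add_left_eq_self
      (fun z => ((κ * Real.exp (-(1 / 2) * ‖z - v‖ ^ 2)) * h z) • innerSL ℝ (z - v)) (v : E)]
    simp [smul_smul, hκ]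
  rw [h1, h2]
  refine hasFDerivAt_integral_of_dominated_of_fderiv_le
    (F := fun v z => (κ * Real.exp (-(1 / 2) * ‖z - v‖ ^ 2)) * h z)
    (F' := fun v z => ((κ * Real.exp (-(1 / 2) * ‖z - v‖ ^ 2)) * h z) • innerSL ℝ (z - v))
    -- For `u` in the unit ball around `v` and `r = ‖z - u‖`, one has `r ≤ e^{r²/4}` and `‖z - v‖² ≤
    -- 2r² + 2`. Hence `r e^{-r²/2} ≤ e^{-r²/4} ≤ e^{1/4} e^{-‖z-v‖²/8}`, uniformly in `u`.
    (bound := fun z => κ * C * Real.exp (1 / 4) * Real.exp (-(1 / 8) * ‖z - v‖ ^ 2))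
    (Metric.ball_mem_nhds v one_pos) ?_ ?_ ?_ ?_ ?_ ?_
  · refine Eventually.of_forall fun v => Measurable.aestronglyMeasurable ?_
    fun_prop
  · refine Integrable.mul_bdd (c := C) ?_ hm.aestronglyMeasurable
      (Eventually.of_forall fun z => hC z)
    exact ((integrable_exp_neg_mul_sq_norm (by norm_num)).comp_sub_right v).const_mul κ
  · refine AEStronglyMeasurable.smul (f := fun z => κ * Real.exp (-(1 / 2) * ‖z - v‖ ^ 2) * h z)
      (Measurable.aestronglyMeasurable (by fun_prop)) ?_
    exact ((innerSL ℝ).continuous.comp (continuous_id.sub continuous_const)).aestronglyMeasurable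
  · refine Eventually.of_forall fun z u hu => ?_
    rw [norm_smul, innerSL_apply_norm, Real.norm_eq_abs, abs_mul, abs_mul, abs_of_pos hκ0,
      abs_of_pos (Real.exp_pos _)]
    set r := ‖z - u‖ with hr
    have hr0 : 0 ≤ r := norm_nonneg _
    have e1 : r ≤ Real.exp (1 / 4 * r ^ 2) := by
      have := Real.add_one_le_exp (1 / 4 * r ^ 2)
      nlinarith [sq_nonneg (r / 2 - 1)]
    have e2 : ‖z - v‖ ^ 2 ≤ 2 * r ^ 2 + 2 := by
      have h3 : ‖z - v‖ ≤ r + 1 := by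
        have := norm_add_le (z - u) (u - v)
        rw [sub_add_sub_cancel] at this
        have h4 : ‖u - v‖ < 1 := by simpa [dist_eq_norm] using hu
        linarith
      nlinarith [norm_nonneg (z - v), sq_nonneg (r - 1)]
    have e3 : Real.exp (-(1 / 2) * r ^ 2) * r
        ≤ Real.exp (1 / 4) * Real.exp (-(1 / 8) * ‖z - v‖ ^ 2) := by
      calc _ ≤ Real.exp (-(1 / 2) * r ^ 2) * Real.exp (1 / 4 * r ^ 2) := by gcongr
        _ = Real.exp (-(1 / 4) * r ^ 2) := by rw [← Real.exp_add]; congr 1; ring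
        _ ≤ Real.exp (1 / 4 + -(1 / 8) * ‖z - v‖ ^ 2) := Real.exp_le_exp.2 (by linarith)
        _ = _ := Real.exp_add _ _
    calc κ * Real.exp (-(1 / 2) * r ^ 2) * |h z| * r
        = κ * |h z| * (Real.exp (-(1 / 2) * r ^ 2) * r) := by ring
      _ ≤ κ * C * (Real.exp (1 / 4) * Real.exp (-(1 / 8) * ‖z - v‖ ^ 2)) := by
          gcongr; exact hC z
      _ = _ := by ring
  · exact ((integrable_exp_neg_mul_sq_norm (by norm_num)).comp_sub_right v).const_mul _
  · refine Eventually.of_forall fun z u _ => ?_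
    have d1 : HasFDerivAt (fun u : E => ‖z - u‖ ^ 2) (-(2 • innerSL ℝ (z - u))) u := by
      have := ((hasFDerivAt_id u).const_sub z).norm_sq
      refine this.congr_fderiv ?_
      ext w; simp; ring
    have d2 := (((d1.const_mul (-(1 / 2))).exp).const_mul κ).mul_const (h z)
    refine d2.congr_fderiv ?_
    ext w
    simp
    ring

lemma integrable_norm_stdGaussian : Integrable (fun g : E => ‖g‖) (stdGaussian E) :=
  (IsGaussian.memLp_id (stdGaussian E) 1 (by simp)).integrable le_rfl |>.norm

/-- Differentiation of `y ↦ E[h (D y + c + S g)]` for a standard Gaussian vector `g`. -/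
lemma hasFDerivAt_integral_affine_stdGaussian {h : E → ℝ} (hm : Measurable h) {C : ℝ}
    (hC : ∀ z, |h z| ≤ C) (D S R : E →L[ℝ] E) (hSR : ∀ x, S (R x) = x) (c y : E) :
    ∃ φ : E →L[ℝ] ℝ, HasFDerivAt (fun y => ∫ g, h (D y + c + S g) ∂(stdGaussian E)) φ y ∧
      ∀ v, φ v = ∫ g, h (D y + c + S g) * ⟪R (D v), g⟫ ∂(stdGaussian E) := by
  have hm' : Measurable fun z => h (c + S z) := hm.comp (by fun_prop)
  -- As `S R = id`, the argument `D y + c + S g` equals `c + S (R D y + g)`: the dependence on `y`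
  -- is a pure shift of `g`, and the chain rule applies.
  have key := (hasFDerivAt_integral_add_stdGaussian hm' (fun z => hC _) (R (D y))).comp y
    (R.comp D).hasFDerivAt
  have harg : ∀ y g, c + S (R (D y) + g) = D y + c + S g := fun y g => by
    rw [map_add, hSR]; abel
  simp only [harg] at key
  have hfun : (fun v => ∫ g, h (c + S (v + g)) ∂(stdGaussian E)) ∘ ⇑(R ∘SL D)
      = fun y => ∫ g, h (D y + c + S g) ∂(stdGaussian E) := by
    ext y
    simp only [Function.comp_apply, ContinuousLinearMap.comp_apply, harg]
  rw [hfun] at key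
  refine ⟨_, key, ?_⟩
  · intro v
    rw [ContinuousLinearMap.comp_apply, ContinuousLinearMap.integral_apply]
    · simp [real_inner_comm]
    · have h1 : Integrable (fun g : E => innerSL ℝ g) (stdGaussian E) :=
        (innerSL ℝ (E := E)).integrable_comp
          ((IsGaussian.memLp_id (stdGaussian E) 1 (by simp)).integrable le_rfl)
      exact h1.bdd_smul (φ := fun g => h (D y + c + S g)) C
        (hm.comp (by fun_prop)).aestronglyMeasurable (Eventually.of_forall fun g => hC _)

end Smoothing

/-! ### Successive integration of independent noise along a chain -/

section Chain

variable {Ω : Type*} {mΩ : MeasurableSpace Ω} {P : Measure Ω} [IsProbabilityMeasure P]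
  {E : Type*} [NormedAddCommGroup E] [MeasurableSpace E] [BorelSpace E]
  [SecondCountableTopology E]

/-- The weighted expectation along a chain `Y (j) = Ψ j (Y (j + 1)) (V j)` with independent noise
integrates the weights one after the other. -/
lemma integral_chain {M : ℕ} {γ : Measure E} [IsProbabilityMeasure γ]
    (hγ : Integrable (fun g => ‖g‖) γ) {V : ℕ → Ω → E} (hV : ∀ j ≤ M, Measurable (V j))
    (hind : iIndepFun (fun l : Fin (M + 1) => V l) P) (hlaw : ∀ j < M, P.map (V j) = γ)
    {Y : ℕ → Ω → E} {Ψ : ℕ → E → E → E} (hΨ : ∀ j < M, Measurable (Function.uncurry (Ψ j)))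
    (hYM : Y M = V M) (hY : ∀ j < M, ∀ ω, Y j ω = Ψ j (Y (j + 1) ω) (V j ω))
    {q : ℕ → E → E → ℝ} (hq : ∀ j < M, Measurable (Function.uncurry (q j)))
    (hqC : ∀ j < M, ∃ C, ∀ y g, |q j y g| ≤ C * ‖g‖)
    {k : ℕ → E → ℝ} (hk : ∀ j ≤ M, Measurable (k j)) (hkC : ∀ j ≤ M, ∃ C, ∀ y, |k j y| ≤ C)
    (hrec : ∀ j < M, ∀ y, k (j + 1) y = ∫ g, k j (Ψ j y g) * q j y g ∂γ)
    {a : Ω → ℝ} (ha : Measurable[MeasurableSpace.comap (V M) inferInstance] a)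
    {C : ℝ} (haC : ∀ ω, |a ω| ≤ C) :
    Integrable (fun ω => a ω *
      (k 0 (Y 0 ω) * ∏ j ∈ Finset.range M, q j (Y (j + 1) ω) (V j ω))) P ∧
    ∫ ω, a ω * (k 0 (Y 0 ω) * ∏ j ∈ Finset.range M, q j (Y (j + 1) ω) (V j ω)) ∂P
      = ∫ ω, a ω * k M (V M ω) ∂P := by
  -- Chain time runs from `M` down to `0`, so the past at `j` is generated by the noise with index
  -- at least `j`; `V M` is the initial state.
  set m : ℕ → MeasurableSpace Ω := fun j =>
    ⨆ l ∈ {l : Fin (M + 1) | j ≤ l}, MeasurableSpace.comap (V l) inferInstance with hm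
  have hle : ∀ l : Fin (M + 1), MeasurableSpace.comap (V l) inferInstance ≤ mΩ := fun l =>
    (hV l (Nat.lt_succ_iff.1 l.2)).comap_le
  have hmle : ∀ j, m j ≤ mΩ := fun j => iSup₂_le fun l _ => hle l
  have hmono : ∀ j, m (j + 1) ≤ m j := fun j =>
    biSup_mono fun l (hl : j + 1 ≤ (l : ℕ)) => (show j ≤ (l : ℕ) by omega)
  have hVm : ∀ j ≤ M, Measurable[m j] (V j) := by
    intro j hj
    refine Measurable.mono (ma := MeasurableSpace.comap (V j) inferInstance)
      (comap_measurable (V j)) ?_ le_rfl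
    exact le_iSup₂_of_le (f := fun (l : Fin (M + 1)) (_ : l ∈ {l : Fin (M + 1) | j ≤ l}) =>
      MeasurableSpace.comap (V l) inferInstance) ⟨j, by omega⟩ (by simp) le_rfl
  set H : ℕ → Ω → ℝ := fun j ω => a ω * ∏ l ∈ Finset.Ico j M, q l (Y (l + 1) ω) (V l ω) with hH
  -- Downward induction from the initial state: `H j` collects the test variable `a` and the weights
  -- of the past, and the expectation of `H j * k j (Y j)` does not depend on `j`.
  have main : ∀ j, j ≤ M → Measurable[m j] (Y j) ∧ Measurable[m j] (H j) ∧ Integrable (H j) P ∧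
      ∫ ω, H j ω * k j (Y j ω) ∂P = ∫ ω, a ω * k M (V M ω) ∂P := by
    intro j hj
    induction hj using Nat.decreasingInduction with
    | self =>
      have haM : Measurable[m M] a := ha.mono (by
        exact le_iSup₂_of_le (f := fun (l : Fin (M + 1)) (_ : l ∈ {l : Fin (M + 1) | M ≤ l}) =>
          MeasurableSpace.comap (V l) inferInstance) ⟨M, by omega⟩ (by simp) le_rfl) le_rfl
      refine ⟨hYM ▸ hVm M le_rfl, by simpa [hH] using haM, ?_, by simp [hH, hYM]⟩
      simp only [hH, Finset.Ico_self, Finset.prod_empty, mul_one]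
      exact Integrable.of_bound (haM.mono (hmle M) le_rfl).aestronglyMeasurable C
        (Eventually.of_forall haC)
    | of_succ j hj ih =>
      obtain ⟨hYm, hHm, hHi, hval⟩ := ih
      have hHj : ∀ ω, H j ω = H (j + 1) ω * q j (Y (j + 1) ω) (V j ω) := by
        intro ω
        simp only [hH, Finset.prod_Ico_eq_prod_range]
        rw [show M - j = M - (j + 1) + 1 by omega, Finset.prod_range_succ']
        simp only [add_zero]
        rw [mul_assoc]
        congr 2
        refine Finset.prod_congr rfl fun l _ => ?_
        rw [show j + (l + 1) = j + 1 + l by omega]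
      have hYj : Measurable[m j] (Y j) := by
        have : Y j = fun ω => Function.uncurry (Ψ j) (Y (j + 1) ω, V j ω) := by
          ext ω; exact hY j hj ω
        rw [this]
        exact (hΨ j hj).comp ((hYm.mono (hmono j) le_rfl).prodMk (hVm j hj.le))
      have hHjm : Measurable[m j] (H j) := by
        have : H j = fun ω => H (j + 1) ω * Function.uncurry (q j) (Y (j + 1) ω, V j ω) := by
          ext ω; exact hHj ω
        rw [this]
        exact (hHm.mono (hmono j) le_rfl).mul
          ((hq j hj).comp ((hYm.mono (hmono j) le_rfl).prodMk (hVm j hj.le)))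
      have hX : Measurable[m (j + 1)] fun ω => (H (j + 1) ω, Y (j + 1) ω) := hHm.prodMk hYm
      have hX' : Measurable fun ω => (H (j + 1) ω, Y (j + 1) ω) := hX.mono (hmle _) le_rfl
      have hVj := hV j hj.le
      have hindep : IndepFun (fun ω => (H (j + 1) ω, Y (j + 1) ω)) (V j) P := by
        have h1 := indep_iSup_of_disjoint hle hind
          (S := {l : Fin (M + 1) | j + 1 ≤ (l : ℕ)}) (T := {⟨j, by omega⟩})
          (by simp)
        rw [iSup_singleton] at h1
        exact indep_of_indep_of_le_left h1 hX.comap_le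
      obtain ⟨D, hD⟩ := hqC j hj
      have hnorm : Integrable (fun ω => ‖V j ω‖) P := by
        have : Integrable (fun g => ‖g‖) (P.map (V j)) := by rwa [hlaw j hj]
        exact this.comp_measurable hVj
      -- The weights are unbounded, but each is at most linear in its own noise, which is integrable
      -- and independent of the earlier product.
      have hHji : Integrable (H j) P := by
        have h2 : Integrable (fun ω => H (j + 1) ω * ‖V j ω‖) P :=
          (hindep.comp measurable_fst measurable_norm).integrable_mul hHi hnorm
        refine (h2.const_mul D).mono (hHjm.mono (hmle j) le_rfl).aestronglyMeasurable
          (Eventually.of_forall fun ω => ?_)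
        rw [hHj, norm_mul (H (j + 1) ω), norm_mul D, norm_mul (H (j + 1) ω), norm_norm,
          Real.norm_eq_abs (q j _ _)]
        calc _ ≤ ‖H (j + 1) ω‖ * (D * ‖V j ω‖) := by gcongr; exact hD _ _
          _ ≤ ‖H (j + 1) ω‖ * (‖D‖ * ‖V j ω‖) := by gcongr; exact Real.le_norm_self D
          _ = _ := by ring
      refine ⟨hYj, hHjm, hHji, ?_⟩
      rw [← hval]
      set φ : (ℝ × E) × E → ℝ := fun x =>
        x.1.1 * Function.uncurry (q j) (x.1.2, x.2) * k j (Function.uncurry (Ψ j) (x.1.2, x.2))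
        with hφ
      have hφm : Measurable φ := by
        have e : Measurable fun x : (ℝ × E) × E => (x.1.2, x.2) := by fun_prop
        exact ((measurable_fst.comp measurable_fst).mul ((hq j hj).comp e)).mul
          ((hk j hj.le).comp ((hΨ j hj).comp e))
      have hmap : P.map (fun ω => ((H (j + 1) ω, Y (j + 1) ω), V j ω))
          = (P.map fun ω => (H (j + 1) ω, Y (j + 1) ω)).prod γ := by
        rw [← hlaw j hj]
        exact (indepFun_iff_map_prod_eq_prod_map_map hX'.aemeasurable hVj.aemeasurable).1 hindep
      have hφω : ∀ ω, H j ω * k j (Y j ω) = φ ((H (j + 1) ω, Y (j + 1) ω), V j ω) := by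
        intro ω
        rw [hHj, hY j hj]
        rfl
      obtain ⟨K, hK⟩ := hkC j hj.le
      have hφi : Integrable (fun ω => φ ((H (j + 1) ω, Y (j + 1) ω), V j ω)) P := by
        refine Integrable.congr ?_ (Eventually.of_forall hφω)
        refine hHji.mul_bdd (c := K) ?_ (Eventually.of_forall fun ω => hK _)
        exact ((hk j hj.le).comp (hYj.mono (hmle j) le_rfl)).aestronglyMeasurable
      have hφi' : Integrable φ ((P.map fun ω => (H (j + 1) ω, Y (j + 1) ω)).prod γ) := by
        rw [← hmap]
        exact (integrable_map_measure hφm.aestronglyMeasurable (hX'.prodMk hVj).aemeasurable).2 hφi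
      have : IsProbabilityMeasure (P.map fun ω => (H (j + 1) ω, Y (j + 1) ω)) :=
        Measure.isProbabilityMeasure_map hX'.aemeasurable
      -- By independence and Fubini, `V j` is integrated first with the past frozen, and `hrec`
      -- identifies the inner integral as `k (j + 1)`.
      calc ∫ ω, H j ω * k j (Y j ω) ∂P
          = ∫ ω, φ ((H (j + 1) ω, Y (j + 1) ω), V j ω) ∂P :=
            integral_congr_ae (Eventually.of_forall hφω)
        _ = ∫ x, φ x ∂((P.map fun ω => (H (j + 1) ω, Y (j + 1) ω)).prod γ) := by
            rw [← hmap, integral_map (hX'.prodMk hVj).aemeasurable hφm.aestronglyMeasurable]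
        _ = ∫ x, x.1 * k (j + 1) x.2 ∂(P.map fun ω => (H (j + 1) ω, Y (j + 1) ω)) := by
            rw [integral_prod _ hφi']
            refine integral_congr_ae (Eventually.of_forall fun x => ?_)
            simp only [hφ, hrec j hj, ← integral_const_mul]
            refine integral_congr_ae (Eventually.of_forall fun g => ?_)
            simp only [Function.uncurry]
            ring
        _ = _ := by
            rw [integral_map hX'.aemeasurable]
            exact (measurable_fst.mul ((hk (j + 1) hj).comp measurable_snd)).aestronglyMeasurable
  obtain ⟨h1, h2, h3, h4⟩ := main 0 M.zero_le
  have heq : ∀ ω, H 0 ω * k 0 (Y 0 ω)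
      = a ω * (k 0 (Y 0 ω) * ∏ j ∈ Finset.range M, q j (Y (j + 1) ω) (V j ω)) := by
    intro ω
    simp only [hH, ← Finset.range_eq_Ico]
    ring
  obtain ⟨K, hK⟩ := hkC 0 M.zero_le
  simp only [heq] at h4
  refine ⟨Integrable.congr ?_ (Eventually.of_forall heq), h4⟩
  refine h3.mul_bdd (c := K) ?_ (Eventually.of_forall fun ω => hK _)
  exact ((hk 0 M.zero_le).comp (h1.mono (hmle 0) le_rfl)).aestronglyMeasurable

/-- The conditional expectation of the weighted terminal value of a chain given its initial
state. -/
lemma condExp_chain {M : ℕ} {γ : Measure E} [IsProbabilityMeasure γ]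
    (hγ : Integrable (fun g => ‖g‖) γ) {V : ℕ → Ω → E} (hV : ∀ j ≤ M, Measurable (V j))
    (hind : iIndepFun (fun l : Fin (M + 1) => V l) P) (hlaw : ∀ j < M, P.map (V j) = γ)
    {Y : ℕ → Ω → E} {Ψ : ℕ → E → E → E} (hΨ : ∀ j < M, Measurable (Function.uncurry (Ψ j)))
    (hYM : Y M = V M) (hY : ∀ j < M, ∀ ω, Y j ω = Ψ j (Y (j + 1) ω) (V j ω))
    {q : ℕ → E → E → ℝ} (hq : ∀ j < M, Measurable (Function.uncurry (q j)))
    (hqC : ∀ j < M, ∃ C, ∀ y g, |q j y g| ≤ C * ‖g‖)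
    {k : ℕ → E → ℝ} (hk : ∀ j ≤ M, Measurable (k j)) (hkC : ∀ j ≤ M, ∃ C, ∀ y, |k j y| ≤ C)
    (hrec : ∀ j < M, ∀ y, k (j + 1) y = ∫ g, k j (Ψ j y g) * q j y g ∂γ) :
    Integrable (fun ω => k 0 (Y 0 ω) * ∏ j ∈ Finset.range M, q j (Y (j + 1) ω) (V j ω)) P ∧
    (fun ω => k M (V M ω)) =ᵐ[P]
      P[fun ω => k 0 (Y 0 ω) * ∏ j ∈ Finset.range M, q j (Y (j + 1) ω) (V j ω) |
        MeasurableSpace.comap (V M) inferInstance] := by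
  have hle := (hV M le_rfl).comap_le
  have hint : Integrable
      (fun ω => k 0 (Y 0 ω) * ∏ j ∈ Finset.range M, q j (Y (j + 1) ω) (V j ω)) P := by
    have := (integral_chain hγ hV hind hlaw hΨ hYM hY hq hqC hk hkC hrec (a := fun _ => 1)
      measurable_const (C := 1) (by simp)).1
    simpa using this
  obtain ⟨K, hK⟩ := hkC M le_rfl
  have hkV : Integrable (fun ω => k M (V M ω)) P :=
    Integrable.of_bound ((hk M le_rfl).comp (hV M le_rfl)).aestronglyMeasurable K
      (Eventually.of_forall fun ω => hK _)
  refine ⟨hint, ae_eq_condExp_of_forall_setIntegral_eq hle hint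
    (fun s _ _ => hkV.integrableOn) (fun s hs _ => ?_) ?_⟩
  -- Indicators of events in the σ-algebra of `V M` serve as the test variables `a`.
  · have h := (integral_chain hγ hV hind hlaw hΨ hYM hY hq hqC hk hkC hrec
      (a := s.indicator fun _ => 1) (measurable_const.indicator hs) (C := 1)
      (fun ω => by by_cases h : ω ∈ s <;> simp [h])).2
    have hs' := hle s hs
    rw [← integral_indicator hs', ← integral_indicator hs']
    have hind1 : ∀ g : Ω → ℝ, s.indicator g = fun ω => s.indicator (fun _ => (1 : ℝ)) ω * g ω := by
      intro g; ext ω; by_cases h : ω ∈ s <;> simp [h]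
    rw [hind1, hind1 (fun ω => k 0 _ * _)]
    exact h.symm
  · exact ((hk M le_rfl).comp (comap_measurable (V M))).aestronglyMeasurable

end Chain

/-! ### A common grid for consecutive intervals -/

section Refinement

/-- The common refinement of the intervals `[θ j, θ (j + 1)]`, with `n` cells for each of them. -/
def refGrid (θ : ℕ → ℝ) (n k : ℕ) : ℝ := gridPt (θ (k / n)) (θ (k / n + 1)) n (k % n)

lemma refGrid_eq (θ : ℕ → ℝ) {n l : ℕ} (j : ℕ) (hl : l < n) :
    refGrid θ n (n * j + l) = gridPt (θ j) (θ (j + 1)) n l := by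
  have h1 : (n * j + l) / n = j := by
    rw [Nat.mul_add_div (by omega), Nat.div_eq_of_lt hl, add_zero]
  have h2 : (n * j + l) % n = l := by rw [Nat.mul_add_mod, Nat.mod_eq_of_lt hl]
  rw [refGrid, h1, h2]

/-- At `l + 1 = n` the index moves on to the first point of the next interval, which is the right
endpoint of the current one. -/
lemma refGrid_succ_eq (θ : ℕ → ℝ) {n l : ℕ} (j : ℕ) (hl : l < n) :
    refGrid θ n (n * j + l + 1) = gridPt (θ j) (θ (j + 1)) n (l + 1) := by
  rcases (Nat.succ_le_of_lt hl).lt_or_eq with h | h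
  · rw [add_assoc, refGrid_eq θ j h]
  · have h3 : n * j + l + 1 = n * (j + 1) + 0 := by rw [mul_add]; omega
    have h4 : l + 1 = n := h
    rw [h3, refGrid_eq θ (j + 1) (by omega), gridPt_zero, h4, gridPt_self (by omega)]

lemma refGrid_mono {θ : ℕ → ℝ} (hθ : Monotone θ) {n : ℕ} (hn : n ≠ 0) :
    Monotone (refGrid θ n) := by
  refine monotone_nat_of_le_succ fun k => ?_
  have hl : k % n < n := Nat.mod_lt _ (Nat.pos_of_ne_zero hn)
  rw [← Nat.div_add_mod k n, refGrid_eq θ _ hl, refGrid_succ_eq θ _ hl]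
  exact gridPt_mono (hθ (Nat.le_succ _)) n (Nat.le_succ _)

lemma sum_range_mul {R : Type*} [AddCommMonoid R] (F : ℕ → R) (n M : ℕ) :
    ∑ k ∈ Finset.range (n * M), F k
      = ∑ j ∈ Finset.range M, ∑ l ∈ Finset.range n, F (n * j + l) := by
  induction M with
  | zero => simp
  | succ M ih => rw [mul_add, mul_one, Finset.sum_range_add, ih, Finset.sum_range_succ]

end Refinement

/-! ### Characteristic functions of Brownian sums and their limits -/

section Brownian

variable {N : ℕ} {Ω : Type*} [MeasurableSpace Ω] {P : Measure Ω}
  {W : ℝ≥0 → Ω → EuclideanSpace ℝ (Fin N)}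

/-- The joint characteristic function of Brownian increments. -/
lemma integral_cexp_increments (hW : IsBrownianVector W P) {u : ℕ → ℝ≥0} (hu : Monotone u)
    (d : ℕ → Fin N → ℝ) (K : ℕ) :
    ∫ ω, Complex.exp (((∑ k ∈ Finset.range K, ∑ p,
        d k p * (W (u (k + 1)) ω p - W (u k) ω p) : ℝ) : ℂ) * Complex.I) ∂P
      = Complex.exp ((-(∑ k ∈ Finset.range K, ∑ p,
          d k p ^ 2 * ((u (k + 1) : ℝ) - u k)) / 2 : ℝ)) := by
  have hWm : ∀ r p, Measurable fun ω => W r ω p := fun r p =>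
    (EuclideanSpace.proj (𝕜 := ℝ) p).continuous.measurable.comp (hW.measurable r)
  set X : Fin N → Fin K → Ω → ℝ := fun p k ω => d k p * (W (u (k + 1)) ω p - W (u k) ω p) with hX
  have hXm : ∀ p k, Measurable (X p k) := fun p k =>
    (Measurable.sub (G := ℝ) (hWm _ _) (hWm _ _)).const_mul _
  -- Independence across coordinates comes from the independence of the `β^p`, and along the times
  -- from independent increments of each. Together they make the whole double family independent, so
  -- the characteristic function of its sum at `1` is a product.
  have h1 : iIndepFun (fun p ω => (X p · ω)) P := by
    refine hW.indep.comp
      (fun p path (k : Fin K) => d k p * (path (u (k + 1)) - path (u k))) fun p => ?_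
    exact measurable_pi_lambda _ fun k => by fun_prop
  have h2 : ∀ p, iIndepFun (X p) P := by
    intro p
    have h := ((hW.brownian p).hasIndepIncrements.nat hu).precomp
      (g := fun k : Fin K => (k : ℕ)) Fin.val_injective
    exact h.comp (fun k x => d k p * x) fun k => measurable_const_mul _
  have hind := iIndepFun_uncurry' hXm h1 h2
  have hlaw : ∀ (q : Fin N × Fin K), charFun (P.map fun ω => X q.1 q.2 ω) 1
      = Complex.exp ((-(d q.2 q.1 ^ 2 * ((u (q.2 + 1) : ℝ) - u q.2)) / 2 : ℝ)) := by
    rintro ⟨p, k⟩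
    have h := gaussianReal_const_mul ((hW.brownian p).hasLaw_sub (u (k + 1)) (u k)) (d k p)
    have h3 : P.map (fun ω => X p k ω) = _ := h.map_eq
    rw [h3, charFun_gaussianReal]
    congr 1
    have h4 : ((nndist (u (k + 1)).1 (u k).1 : ℝ≥0) : ℝ) = (u (k + 1) : ℝ) - u k := by
      rw [coe_nndist, Real.dist_eq]
      exact abs_of_nonneg (sub_nonneg.2 (NNReal.coe_le_coe.2 (hu (Nat.le_succ _))))
    have h5 : (((NNReal.mk (d k p ^ 2) (sq_nonneg _) * nndist (u (k + 1)).1 (u k).1 : ℝ≥0) : ℝ) : ℂ)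
        = ((d k p ^ 2 * ((u (k + 1) : ℝ) - u k) : ℝ) : ℂ) := by
      rw [NNReal.coe_mul, h4]; rfl
    rw [h5]
    push_cast
    ring
  have hsum := congrFun (iIndepFun.charFun_map_fun_sum_eq_prod (P := P)
    (X := fun (q : Fin N × Fin K) ω => X q.1 q.2 ω)
    (fun q => (hXm q.1 q.2).aemeasurable) hind) 1
  rw [charFun_apply_real, integral_map
    (Finset.measurable_fun_sum _ fun q _ => hXm q.1 q.2).aemeasurable (by fun_prop), Finset.prod_apply] at hsum
  simp only [hlaw] at hsum
  rw [← Complex.exp_sum] at hsum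
  have e1 : ∀ ω, (∑ k ∈ Finset.range K, ∑ p, d k p * (W (u (k + 1)) ω p - W (u k) ω p) : ℝ)
      = ∑ q : Fin N × Fin K, X q.1 q.2 ω := by
    intro ω
    rw [Fintype.sum_prod_type_right, Finset.sum_range]
  simp only [e1]
  simp only [Complex.ofReal_one, one_mul] at hsum
  rw [hsum]
  congr 1
  rw [← Complex.ofReal_sum, Fintype.sum_prod_type_right, Finset.sum_range]
  simp only [neg_div, Finset.sum_neg_distrib, Finset.sum_div]

/-- The process `σ W_{ℓ_r}`, one component at a time. -/
def timeChanged (sig : Fin N → ℝ) (W : ℝ≥0 → Ω → EuclideanSpace ℝ (Fin N)) (ℓ : TimeChange)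
    (ω : Ω) (p : Fin N) (r : ℝ) : ℝ :=
  |sig p| * W (ℓ.toFun r.toNNReal).toNNReal ω p

/-- Limits of Riemann-Stieltjes sums against the time-changed Brownian motion are jointly
Gaussian, with independent components. -/
lemma integral_cexp_of_tendsto [IsProbabilityMeasure P] (hW : IsBrownianVector W P) {lam : Fin N → ℝ}
    (hlam : ∀ p, 0 < lam p) (sig : Fin N → ℝ) (ℓ : TimeChange) {θ : ℕ → ℝ} {M : ℕ}
    (hθ : Monotone θ) (hθs : ∀ j < M, θ j < θ (j + 1)) (c : ℕ → Fin N → ℝ)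
    {X : Ω → ℕ → Fin N → ℝ}
    (hX : ∀ᵐ ω ∂P, ∀ j < M, ∀ p, Tendsto (fun n : ℕ => ∑ l ∈ Finset.range n,
      Real.exp (-(lam p * (θ (j + 1) - gridPt (θ j) (θ (j + 1)) n l)))
        * (timeChanged sig W ℓ ω p (gridPt (θ j) (θ (j + 1)) n (l + 1))
          - timeChanged sig W ℓ ω p (gridPt (θ j) (θ (j + 1)) n l))) atTop (𝓝 (X ω j p))) :
    ∫ ω, Complex.exp (((∑ j ∈ Finset.range M, ∑ p, c j p * X ω j p : ℝ) : ℂ) * Complex.I) ∂P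
      = Complex.exp ((-(∑ j ∈ Finset.range M, ∑ p,
          c j p ^ 2 * covDiag lam sig ℓ (θ j) (θ (j + 1)) p) / 2 : ℝ)) := by
  have hWm : ∀ r p, Measurable fun ω => W r ω p := fun r p =>
    (EuclideanSpace.proj (𝕜 := ℝ) p).continuous.measurable.comp (hW.measurable r)
  set S : ℕ → Ω → ℝ := fun n ω => ∑ j ∈ Finset.range M, ∑ p, c j p * ∑ l ∈ Finset.range n,
      Real.exp (-(lam p * (θ (j + 1) - gridPt (θ j) (θ (j + 1)) n l)))
        * (timeChanged sig W ℓ ω p (gridPt (θ j) (θ (j + 1)) n (l + 1))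
          - timeChanged sig W ℓ ω p (gridPt (θ j) (θ (j + 1)) n l)) with hS
  -- The variance of `S n`. Squaring the coefficients `e^{-λ(…)}` doubles the rate, which is the `2`
  -- in `I^ℓ`.
  set v : ℕ → ℝ := fun n => ∑ j ∈ Finset.range M, ∑ p, c j p ^ 2 * (sig p ^ 2 *
      ∑ l ∈ Finset.range n, Real.exp (-(2 * lam p * (θ (j + 1) - gridPt (θ j) (θ (j + 1)) n l)))
        * (ℓ.stieltjes (gridPt (θ j) (θ (j + 1)) n (l + 1))
          - ℓ.stieltjes (gridPt (θ j) (θ (j + 1)) n l))) with hv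
  have hSm : ∀ n, Measurable (S n) := by
    intro n
    refine Finset.measurable_fun_sum _ fun j _ => Finset.measurable_fun_sum _ fun p _ =>
      (Finset.measurable_fun_sum _ fun l _ => ?_).const_mul _
    exact (Measurable.sub (G := ℝ) ((hWm _ _).const_mul _) ((hWm _ _).const_mul _)).const_mul _
  have hv_lim : Tendsto v atTop (𝓝 (∑ j ∈ Finset.range M, ∑ p,
      c j p ^ 2 * covDiag lam sig ℓ (θ j) (θ (j + 1)) p)) := by
    refine tendsto_finsetSum _ fun j hj => tendsto_finsetSum _ fun p _ => ?_
    refine Tendsto.const_mul _ (Tendsto.const_mul _ ?_)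
    exact tendsto_sum_exp_mul_stieltjes (hθs j (Finset.mem_range.1 hj))
      (by have := hlam p; positivity) ℓ.stieltjes
  -- All intervals together use one increasing sequence of Brownian times, the images under `ℓ` of
  -- the common grid. This yields independence within and between intervals at once.
  have hstep : ∀ n, n ≠ 0 → ∫ ω, Complex.exp ((S n ω : ℂ) * Complex.I) ∂P
      = Complex.exp ((-(v n) / 2 : ℝ)) := by
    intro n hn
    set u : ℕ → ℝ≥0 := fun k => (ℓ.toFun (refGrid θ n k).toNNReal).toNNReal with hu
    have humono : Monotone u := fun k k' hk => Real.toNNReal_le_toNNReal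
      (ℓ.strictMono.monotone (Real.toNNReal_le_toNNReal (refGrid_mono hθ hn hk)))
    have hu_coe : ∀ k, (u k : ℝ) = ℓ.stieltjes (refGrid θ n k) := fun k =>
      Real.coe_toNNReal _ (ℓ.nonneg _)
    set d : ℕ → Fin N → ℝ := fun k p => c (k / n) p *
      (Real.exp (-(lam p * (θ (k / n + 1) - refGrid θ n k))) * |sig p|) with hd
    have hdiv : ∀ j l, l < n → (n * j + l) / n = j := fun j l hl => by
      rw [Nat.mul_add_div (by omega), Nat.div_eq_of_lt hl, add_zero]
    have h := integral_cexp_increments hW humono d (n * M)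
    have e1 : ∀ ω, ∑ k ∈ Finset.range (n * M), ∑ p, d k p * (W (u (k + 1)) ω p - W (u k) ω p)
        = S n ω := by
      intro ω
      rw [sum_range_mul]
      refine Finset.sum_congr rfl fun j _ => ?_
      rw [Finset.sum_comm]
      refine Finset.sum_congr rfl fun p _ => ?_
      rw [Finset.mul_sum]
      refine Finset.sum_congr rfl fun l hl => ?_
      have hl' := Finset.mem_range.1 hl
      simp only [hd, hu, timeChanged, hdiv j l hl', refGrid_eq θ j hl', refGrid_succ_eq θ j hl']
      ring
    have e2 : ∑ k ∈ Finset.range (n * M), ∑ p, d k p ^ 2 * ((u (k + 1) : ℝ) - u k) = v n := by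
      rw [sum_range_mul]
      refine Finset.sum_congr rfl fun j _ => ?_
      rw [Finset.sum_comm]
      refine Finset.sum_congr rfl fun p _ => ?_
      rw [Finset.mul_sum, Finset.mul_sum]
      refine Finset.sum_congr rfl fun l hl => ?_
      have hl' := Finset.mem_range.1 hl
      simp only [hu_coe]
      simp only [hd, hdiv j l hl', refGrid_eq θ j hl', refGrid_succ_eq θ j hl']
      rw [mul_pow, mul_pow, sq_abs, ← Real.exp_nat_mul]
      have : ((2 : ℕ) : ℝ) * -(lam p * (θ (j + 1) - gridPt (θ j) (θ (j + 1)) n l))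
          = -(2 * lam p * (θ (j + 1) - gridPt (θ j) (θ (j + 1)) n l)) := by push_cast; ring
      rw [this]
      ring
    simpa only [e1, e2] using h
  have hlim : Tendsto (fun n => ∫ ω, Complex.exp ((S n ω : ℂ) * Complex.I) ∂P) atTop
      (𝓝 (∫ ω, Complex.exp (((∑ j ∈ Finset.range M, ∑ p, c j p * X ω j p : ℝ) : ℂ)
        * Complex.I) ∂P)) := by
    refine tendsto_integral_of_dominated_convergence (fun _ => 1) (fun n => ?_)
      (integrable_const _) (fun n => Eventually.of_forall fun ω => ?_) ?_
    · have := hSm n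
      exact Measurable.aestronglyMeasurable (by fun_prop)
    · rw [Complex.norm_exp_ofReal_mul_I]
    · filter_upwards [hX] with ω hω
      have hcont : Continuous fun r : ℝ => Complex.exp ((r : ℂ) * Complex.I) := by fun_prop
      refine (hcont.tendsto _).comp ?_
      exact tendsto_finsetSum _ fun j hj => tendsto_finsetSum _ fun p _ =>
        (hω j (Finset.mem_range.1 hj) p).const_mul _
  refine tendsto_nhds_unique hlim 
    (Tendsto.congr' (f₁ := fun n => Complex.exp ((-(v n) / 2 : ℝ))) ?_ ?_)
  · filter_upwards [eventually_ne_atTop 0] with n hn using (hstep n hn).symm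
  · have hcont : Continuous fun r : ℝ => Complex.exp ((-r / 2 : ℝ)) := by fun_prop
    exact (hcont.tendsto _).comp hv_lim

end Brownian

/-! ### Law of the normalised increments -/

section Law

variable {N : ℕ} {Ω : Type*} [MeasurableSpace Ω] {P : Measure Ω}
  {W : ℝ≥0 → Ω → EuclideanSpace ℝ (Fin N)} {lam sig : Fin N → ℝ} {T : ℝ}
  {f : ℝ → EuclideanSpace ℝ (Fin N)} {ℓ : TimeChange} {a₀ : ℝ} {x : EuclideanSpace ℝ (Fin N)}
  {z : ℝ → Ω → EuclideanSpace ℝ (Fin N)}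

/-- The stochastic convolution of an Ornstein-Uhlenbeck process is almost surely the limit of
Riemann-Stieltjes sums against the time-changed Brownian motion. -/
lemma IsOUProcess.ae_tendsto (hW : IsBrownianVector W P) (hf : ContinuousOn f (Icc 0 T))
    (ha₀ : 0 ≤ a₀) (hz : IsOUProcess (-Matrix.diagonal lam) (Matrix.diagonal fun p => sig p ^ 2)
      f T W P ℓ a₀ x z) :
    ∀ᵐ ω ∂P, ∀ a b, a₀ ≤ a → a < b → b ≤ T → ∀ p,
      Tendsto (fun n : ℕ => ∑ l ∈ Finset.range n,
        Real.exp (-(lam p * (b - gridPt a b n l)))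
          * (timeChanged sig W ℓ ω p (gridPt a b n (l + 1))
            - timeChanged sig W ℓ ω p (gridPt a b n l))) atTop
        (𝓝 ((z b ω - act (expMat (-Matrix.diagonal lam) (b - a)) (z a ω)
          - driftInt (-Matrix.diagonal lam) f a b) p)) := by
  filter_upwards [hz.cadlag, hz.eqn, ae_all_iff.2 fun p => (hW.brownian p).cont]
    with ω hcad heqn hcont a b ha hab hbT p
  have h0b : a₀ ≤ b := ha.trans hab.le
  obtain ⟨C, hC⟩ := hcad.exists_bound
  have hsub : Icc a₀ b ⊆ Icc a₀ T := Icc_subset_Icc_right hbT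
  have hsub0 : Icc a₀ b ⊆ Icc 0 T := Icc_subset_Icc ha₀ hbT
  have hzr : ∀ r ∈ Icc a₀ b, ContinuousWithinAt (fun t => z t ω) (Icc a₀ b ∩ Ici r) r :=
    fun r hr => (hcad r (hsub hr)).1.mono (inter_subset_inter_left _ hsub)
  have hproj : ∀ q, Continuous fun y : EuclideanSpace ℝ (Fin N) => y q := fun q =>
    (EuclideanSpace.proj (𝕜 := ℝ) q).continuous
  set A : Matrix (Fin N) (Fin N) ℝ := -Matrix.diagonal lam with hA
  have hAdiag : A = Matrix.diagonal fun q => -lam q := by rw [hA, Matrix.diagonal_neg]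
  have heqp : ∀ r ∈ Icc a₀ b, z r ω p = x p + (∫ u in a₀..r, (-(lam p * z u ω p) + f u p))
      + (timeChanged sig W ℓ ω p r - timeChanged sig W ℓ ω p a₀) := by
    intro r hr
    have hsubr : Icc a₀ r ⊆ Icc a₀ b := Icc_subset_Icc_right hr.2
    have hint : IntervalIntegrable (fun u => act A (z u ω) + f u) volume a₀ r := by
      refine IntervalIntegrable.add ?_ ?_
      · refine intervalIntegrable_of_rightCont hr.1 (C := ‖actL A‖ * C) (fun u hu => ?_)
          fun u hu => ?_
        · exact (actL A).continuous.continuousAt.comp_continuousWithinAt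
            ((hzr u (hsubr hu)).mono (inter_subset_inter_left _ hsubr))
        · rw [← actL_apply]
          exact ((actL A).le_opNorm _).trans
            (mul_le_mul_of_nonneg_left (hC u (hsub (hsubr hu))) (norm_nonneg _))
      · refine (hf.mono ?_).intervalIntegrable
        rw [uIcc_of_le hr.1]
        exact hsubr.trans hsub0
    have hI : (∫ u in a₀..r, (act A (z u ω) + f u)) p
        = ∫ u in a₀..r, (-(lam p * z u ω p) + f u p) := by
      refine ((EuclideanSpace.proj (𝕜 := ℝ) p).intervalIntegral_comp_comm hint).symm.trans ?_
      refine intervalIntegral.integral_congr fun u _ => ?_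
      simp only [PiLp.proj_apply, PiLp.add_apply, hAdiag, act_diagonal_apply, neg_mul]
    have h := congrArg (fun y : EuclideanSpace ℝ (Fin N) => y p) (heqn r (hsub hr))
    simp only [PiLp.add_apply, sqrtMat_diagonal fun q => sq_nonneg (sig q), act_diagonal_apply,
      PiLp.sub_apply, Real.sqrt_sq_eq_abs] at h
    rw [hI, mul_sub] at h
    exact h
  -- Continuous Brownian paths composed with the right-continuous `ℓ` are right-continuous, which is
  -- all that the Riemann-Stieltjes limit requires besides boundedness.
  have hw : ∀ r ∈ Icc a b, ContinuousWithinAt (timeChanged sig W ℓ ω p) (Icc a b ∩ Ici r) r := by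
    intro r _
    refine ContinuousWithinAt.const_mul 
      (f := fun r : ℝ => W (ℓ.toFun r.toNNReal).toNNReal ω p) ?_ _
    refine (hcont p).continuousAt.comp_continuousWithinAt
      (continuous_real_toNNReal.continuousAt.comp_continuousWithinAt ?_)
    exact (ℓ.stieltjes.right_continuous r).mono inter_subset_right
  obtain ⟨D, hD⟩ := (isCompact_Icc (a := (0 : ℝ≥0))
    (b := (ℓ.toFun b.toNNReal).toNNReal)).exists_bound_of_continuousOn (hcont p).continuousOn
  have hwD : ∀ r ∈ Icc a b, |timeChanged sig W ℓ ω p r| ≤ |sig p| * D := by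
    intro r hr
    rw [timeChanged, abs_mul, abs_abs]
    refine mul_le_mul_of_nonneg_left (hD _ ⟨zero_le, ?_⟩) (abs_nonneg _)
    exact Real.toNNReal_le_toNNReal (ℓ.strictMono.monotone (Real.toNNReal_le_toNNReal hr.2))
  have key := linear_eqn_increment ha hab.le (z := fun r => z r ω p) (f := fun r => f r p)
    (fun r hr => (hproj p).continuousAt.comp_continuousWithinAt (hzr r hr)) (C := C)
    (fun r hr => (PiLp.norm_apply_le (z r ω) p).trans (hC r (hsub hr)))
    ((hproj p).comp_continuousOn (hf.mono hsub0)) heqp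
  have hlhs : (z b ω - act (expMat A (b - a)) (z a ω) - driftInt A f a b) p
      = z b ω p - Real.exp (-(lam p * (b - a))) * z a ω p
        - ∫ r in a..b, Real.exp (-(lam p * (b - r))) * f r p := by
    rw [PiLp.sub_apply, PiLp.sub_apply, hA, driftInt_apply lam hab.le
      (hf.mono ((Icc_subset_Icc_left ha).trans hsub0)), expMat_neg_diagonal, act_diagonal_apply]
  rw [hlhs, key]
  exact tendsto_sum_exp_mul_sub hab (lam p) hw hwD

lemma IsOUProcess.measurable_normIncr {A Q : Matrix (Fin N) (Fin N) ℝ}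
    (hz : IsOUProcess A Q f T W P ℓ a₀ x z) {a b : ℝ} (ha : a₀ ≤ a) (hab : a ≤ b) (hbT : b ≤ T) :
    Measurable fun ω => normIncr A Q f ℓ (fun r => z r ω) a b := by
  refine (measurable_act _).comp (Measurable.sub_const (Measurable.sub ?_ ?_) _)
  · exact hz.measurable b ⟨ha.trans hab, hbT⟩
  · exact (measurable_act _).comp (hz.measurable a ⟨ha, hab.trans hbT⟩)

/-- The joint characteristic function of the normalised increments of an Ornstein-Uhlenbeck
process. -/
lemma IsOUProcess.integral_cexp_normIncr [IsProbabilityMeasure P] (hW : IsBrownianVector W P)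
    (hlam : ∀ p, 0 < lam p) (hsig : ∀ p, 0 < sig p ^ 2) (hf : ContinuousOn f (Icc 0 T)) (ha₀ : 0 ≤ a₀)
    (hz : IsOUProcess (-Matrix.diagonal lam) (Matrix.diagonal fun p => sig p ^ 2)
      f T W P ℓ a₀ x z) {θ : ℕ → ℝ} {M : ℕ} (hθ : Monotone θ) (hθs : ∀ j < M, θ j < θ (j + 1))
    (hθ0 : a₀ ≤ θ 0) (hθT : θ M ≤ T) (c : ℕ → EuclideanSpace ℝ (Fin N)) :
    ∫ ω, Complex.exp (((∑ j ∈ Finset.range M,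
        ⟪normIncr (-Matrix.diagonal lam) (Matrix.diagonal fun p => sig p ^ 2) f ℓ
          (fun r => z r ω) (θ j) (θ (j + 1)), c j⟫ : ℝ) : ℂ) * Complex.I) ∂P
      = Complex.exp ((-(∑ j ∈ Finset.range M, ‖c j‖ ^ 2) / 2 : ℝ)) := by
  have hpos : ∀ j < M, ∀ p, 0 < covDiag lam sig ℓ (θ j) (θ (j + 1)) p := fun j hj p =>
    covDiag_pos hsig ℓ (ha₀.trans (hθ0.trans (hθ j.zero_le))) (hθs j hj) p
  set X : Ω → ℕ → Fin N → ℝ := fun ω j p =>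
    (z (θ (j + 1)) ω - act (expMat (-Matrix.diagonal lam) (θ (j + 1) - θ j)) (z (θ j) ω)
          - driftInt (-Matrix.diagonal lam) f (θ j) (θ (j + 1))) p with hX
  have h := integral_cexp_of_tendsto hW hlam sig ℓ hθ hθs
    (fun j p => c j p * (√(covDiag lam sig ℓ (θ j) (θ (j + 1)) p))⁻¹) (X := X) (by
      filter_upwards [hz.ae_tendsto hW hf ha₀] with ω hω j hj p
      exact hω _ _ (hθ0.trans (hθ j.zero_le)) (hθs j hj) ((hθ hj).trans hθT) p)
  have e1 : ∀ ω, ∑ j ∈ Finset.range M,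
        ⟪normIncr (-Matrix.diagonal lam) (Matrix.diagonal fun p => sig p ^ 2) f ℓ
          (fun r => z r ω) (θ j) (θ (j + 1)), c j⟫
      = ∑ j ∈ Finset.range M, ∑ p,
          c j p * (√(covDiag lam sig ℓ (θ j) (θ (j + 1)) p))⁻¹ * X ω j p := by
    intro ω
    refine Finset.sum_congr rfl fun j hj => ?_
    rw [normIncr, covMat_eq_diagonal, invSqrtMat_diagonal (hpos j (Finset.mem_range.1 hj)),
      PiLp.inner_apply]
    refine Finset.sum_congr rfl fun p _ => ?_
    rw [act_diagonal_apply]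
    simp only [hX, RCLike.inner_apply, conj_trivial]
    ring
  have e2 : ∑ j ∈ Finset.range M, ∑ p,
      (c j p * (√(covDiag lam sig ℓ (θ j) (θ (j + 1)) p))⁻¹) ^ 2
        * covDiag lam sig ℓ (θ j) (θ (j + 1)) p = ∑ j ∈ Finset.range M, ‖c j‖ ^ 2 := by
    refine Finset.sum_congr rfl fun j hj => ?_
    rw [EuclideanSpace.norm_sq_eq]
    refine Finset.sum_congr rfl fun p _ => ?_
    have := hpos j (Finset.mem_range.1 hj) p
    rw [mul_pow, inv_pow, Real.sq_sqrt this.le, mul_assoc, inv_mul_cancel₀ this.ne', mul_one,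
      Real.norm_eq_abs, sq_abs]
  simp only [e1]
  rw [h, e2]

/-- The normalised increments of an Ornstein-Uhlenbeck process over consecutive intervals are
independent standard Gaussian vectors. -/
lemma IsOUProcess.normIncr_iid [IsProbabilityMeasure P] (hW : IsBrownianVector W P)
    (hlam : ∀ p, 0 < lam p) (hsig : ∀ p, 0 < sig p ^ 2) (hf : ContinuousOn f (Icc 0 T)) (ha₀ : 0 ≤ a₀)
    (hz : IsOUProcess (-Matrix.diagonal lam) (Matrix.diagonal fun p => sig p ^ 2)
      f T W P ℓ a₀ x z) {θ : ℕ → ℝ} {M : ℕ} (hθ : Monotone θ) (hθs : ∀ j < M, θ j < θ (j + 1))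
    (hθ0 : a₀ ≤ θ 0) (hθT : θ M ≤ T) :
    (∀ j : Fin M, P.map (fun ω => normIncr (-Matrix.diagonal lam)
        (Matrix.diagonal fun p => sig p ^ 2) f ℓ (fun r => z r ω) (θ j) (θ (j + 1)))
      = stdGaussian (EuclideanSpace ℝ (Fin N))) ∧
    iIndepFun (fun (j : Fin M) ω => normIncr (-Matrix.diagonal lam)
      (Matrix.diagonal fun p => sig p ^ 2) f ℓ (fun r => z r ω) (θ j) (θ (j + 1))) P := by
  set G : ℕ → Ω → EuclideanSpace ℝ (Fin N) := fun j ω => normIncr (-Matrix.diagonal lam)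
      (Matrix.diagonal fun p => sig p ^ 2) f ℓ (fun r => z r ω) (θ j) (θ (j + 1)) with hG
  have hGm : ∀ j : Fin M, Measurable (G j) := fun j =>
    hz.measurable_normIncr (hθ0.trans (hθ j.1.zero_le)) (hθs j j.2).le ((hθ j.2).trans hθT)
  have key := hz.integral_cexp_normIncr hW hlam hsig hf ha₀ hθ hθs hθ0 hθT
  have hlaw : ∀ j : Fin M, P.map (G j) = stdGaussian (EuclideanSpace ℝ (Fin N)) := by
    intro j
    have : IsProbabilityMeasure (P.map (G j)) := Measure.isProbabilityMeasure_map
      (hGm j).aemeasurable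
    refine Measure.ext_of_charFun ?_
    ext t
    have h := key fun l => if l = j then t else 0
    rw [charFun_stdGaussian, charFun_apply, integral_map (hGm j).aemeasurable (by fun_prop)]
    have hj := Finset.mem_range.2 j.2
    have e1 : ∀ ω, ∑ l ∈ Finset.range M, ⟪G l ω, if l = j then t else 0⟫ = ⟪G j ω, t⟫ := by
      intro ω
      rw [Finset.sum_eq_single_of_mem (j : ℕ) hj fun l _ hl => by rw [if_neg hl, inner_zero_right],
        if_pos rfl]
    have e2 : ∑ l ∈ Finset.range M, ‖if l = (j : ℕ) then t else 0‖ ^ 2 = ‖t‖ ^ 2 := by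
      rw [Finset.sum_eq_single_of_mem (j : ℕ) hj fun l _ hl => by rw [if_neg hl]; simp, if_pos rfl]
    rw [e2] at h
    refine Eq.trans ?_ (h.trans ?_)
    · refine integral_congr_ae (Eventually.of_forall fun ω => ?_)
      simp only [← e1 ω]
      rfl
    · push_cast; rfl
  refine ⟨hlaw, ?_⟩
  -- The joint characteristic function is the exponential of a sum over `j`, that is, the product of
  -- the marginal ones.
  rw [iIndepFun_iff_charFun_pi fun j => (hGm j).aemeasurable]
  intro t
  simp only [hlaw, charFun_stdGaussian]
  have hGm' : Measurable fun ω => WithLp.toLp 2 fun j : Fin M => G j ω :=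
    (PiLp.continuous_toLp 2 _).measurable.comp (measurable_pi_lambda _ hGm)
  rw [charFun_apply, integral_map hGm'.aemeasurable (by fun_prop), ← Complex.exp_sum]
  have h := key fun l => if hl : l < M then t ⟨l, hl⟩ else 0
  have e2 : ∑ l ∈ Finset.range M, ‖if hl : l < M then t ⟨l, hl⟩ else 0‖ ^ 2
      = ∑ j : Fin M, ‖t j‖ ^ 2 := by
    rw [Finset.sum_range]
    exact Finset.sum_congr rfl fun j _ => by rw [dif_pos j.2]
  rw [e2] at h
  refine Eq.trans ?_ (h.trans ?_)
  · refine integral_congr_ae (Eventually.of_forall fun ω => ?_)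
    simp only
    congr 3
    rw [PiLp.inner_apply, Finset.sum_range]
    exact Finset.sum_congr rfl fun j _ => by rw [dif_pos j.2]
  · congr 1
    push_cast
    rw [← Finset.sum_neg_distrib, Finset.sum_div]

end Law

/-! ### Transitions, gradient weights and one step of the iteration -/

section Step

variable {N : ℕ} {Ω : Type*} [MeasurableSpace Ω] {P : Measure Ω}
  {W : ℝ≥0 → Ω → EuclideanSpace ℝ (Fin N)} {lam sig : Fin N → ℝ} {T : ℝ}
  {f : ℝ → EuclideanSpace ℝ (Fin N)} {ℓ : TimeChange} {a₀ : ℝ} {x : EuclideanSpace ℝ (Fin N)}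
  {z : ℝ → Ω → EuclideanSpace ℝ (Fin N)}

lemma IsOUProcess.ae_start {A Q : Matrix (Fin N) (Fin N) ℝ}
    (hz : IsOUProcess A Q f T W P ℓ a₀ x z) (haT : a₀ ≤ T) : ∀ᵐ ω ∂P, z a₀ ω = x := by
  filter_upwards [hz.eqn] with ω hω
  have h := hω a₀ ⟨le_rfl, haT⟩
  rw [intervalIntegral.integral_same, sub_self, add_zero] at h
  rw [h, ← actL_apply, map_zero, add_zero]

/-- The transition map of the Ornstein-Uhlenbeck process from time `a` to time `b`, driven by a
standard Gaussian vector `g`. -/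
def transition (lam sig : Fin N → ℝ) (f : ℝ → EuclideanSpace ℝ (Fin N)) (ℓ : TimeChange)
    (a b : ℝ) (y g : EuclideanSpace ℝ (Fin N)) : EuclideanSpace ℝ (Fin N) :=
  act (expMat (-Matrix.diagonal lam) (b - a)) y + driftInt (-Matrix.diagonal lam) f a b
    + act (sqrtMat (covMat (-Matrix.diagonal lam) (Matrix.diagonal fun p => sig p ^ 2) ℓ a b)) g

lemma measurable_transition (lam sig : Fin N → ℝ) (f : ℝ → EuclideanSpace ℝ (Fin N))
    (ℓ : TimeChange) (a b : ℝ) : Measurable (Function.uncurry (transition lam sig f ℓ a b)) :=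
  (((measurable_act _).comp measurable_fst).add_const _).add ((measurable_act _).comp measurable_snd)

lemma measurable_transition_right (lam sig : Fin N → ℝ) (f : ℝ → EuclideanSpace ℝ (Fin N))
    (ℓ : TimeChange) (a b : ℝ) (y : EuclideanSpace ℝ (Fin N)) :
    Measurable (transition lam sig f ℓ a b y) :=
  (measurable_act _).const_add _

/-- With the same `ℓ` on both sides, `I^{1/2}` undoes the normalisation, so a path is recovered
exactly from its own increment. -/
lemma transition_normIncr (hsig : ∀ p, 0 < sig p ^ 2) {a b : ℝ} (ha : 0 ≤ a) (hab : a < b)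
    (ζ : ℝ → EuclideanSpace ℝ (Fin N)) :
    transition lam sig f ℓ a b (ζ a) (normIncr (-Matrix.diagonal lam)
      (Matrix.diagonal fun p => sig p ^ 2) f ℓ ζ a b) = ζ b := by
  rw [transition, normIncr, act_sqrtMat_act_invSqrtMat (covMat_eq_diagonal lam sig ℓ a b)
    (covDiag_pos hsig ℓ ha hab)]
  abel

/-- The weight of the gradient formula for the transition from time `a` to time `b`. -/
def gradWeight (lam sig : Fin N → ℝ) (ℓ : TimeChange) (a b : ℝ)
    (v g : EuclideanSpace ℝ (Fin N)) : ℝ :=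
  ⟪act (invSqrtMat (covMat (-Matrix.diagonal lam) (Matrix.diagonal fun p => sig p ^ 2) ℓ a b))
    (act (expMat (-Matrix.diagonal lam) (b - a)) v), g⟫

lemma continuous_gradWeight (lam sig : Fin N → ℝ) (ℓ : TimeChange) (a b : ℝ) :
    Continuous (Function.uncurry (gradWeight lam sig ℓ a b)) :=
  Continuous.inner (((actL _).comp (actL _)).continuous.comp continuous_fst) continuous_snd

lemma measurable_gradWeight (lam sig : Fin N → ℝ) (ℓ : TimeChange) (a b : ℝ)
    {v : EuclideanSpace ℝ (Fin N) → EuclideanSpace ℝ (Fin N)} (hv : Measurable v) :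
    Measurable fun x : EuclideanSpace ℝ (Fin N) × EuclideanSpace ℝ (Fin N) =>
      gradWeight lam sig ℓ a b (v x.1) x.2 :=
  (continuous_gradWeight lam sig ℓ a b).measurable.comp
    (f := fun x : EuclideanSpace ℝ (Fin N) × EuclideanSpace ℝ (Fin N) => (v x.1, x.2))
    ((hv.comp measurable_fst).prodMk measurable_snd)

/-- Linear growth in the noise keeps the weight integrable, and linear growth in `v` turns a bounded
vector field into a bound uniform in the state. -/
lemma abs_gradWeight_le (lam sig : Fin N → ℝ) (ℓ : TimeChange) (a b : ℝ) :
    ∃ K, 0 ≤ K ∧ ∀ v g, |gradWeight lam sig ℓ a b v g| ≤ K * ‖v‖ * ‖g‖ := by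
  refine ⟨‖(actL (invSqrtMat (covMat (-Matrix.diagonal lam)
    (Matrix.diagonal fun p => sig p ^ 2) ℓ a b))).comp
      (actL (expMat (-Matrix.diagonal lam) (b - a)))‖, norm_nonneg _, fun v g => ?_⟩
  refine (abs_real_inner_le_norm _ _).trans ?_
  gcongr
  exact ContinuousLinearMap.le_opNorm ((actL _).comp (actL _)) v

/-- The transition semigroup of the Ornstein-Uhlenbeck process. -/
lemma IsOUProcess.integral_comp [IsProbabilityMeasure P] (hW : IsBrownianVector W P)
    (hlam : ∀ p, 0 < lam p) (hsig : ∀ p, 0 < sig p ^ 2) (hf : ContinuousOn f (Icc 0 T))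
    (ha₀ : 0 ≤ a₀) (hz : IsOUProcess (-Matrix.diagonal lam) (Matrix.diagonal fun p => sig p ^ 2)
      f T W P ℓ a₀ x z) {b : ℝ} (hab : a₀ < b) (hbT : b ≤ T)
    {h : EuclideanSpace ℝ (Fin N) → ℝ} (hm : Measurable h) :
    ∫ ω, h (z b ω) ∂P = ∫ g, h (transition lam sig f ℓ a₀ b x g)
      ∂(stdGaussian (EuclideanSpace ℝ (Fin N))) := by
  -- The case of a single interval; the sequence stays at `b` after index `0` because it has to be
  -- monotone on all of `ℕ`.
  have hlaw := (hz.normIncr_iid hW hlam hsig hf ha₀ (M := 1)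
    (θ := fun k => if k = 0 then a₀ else b)
    (monotone_nat_of_le_succ fun k => by by_cases hk : k = 0 <;> simp [hk, hab.le])
    (fun j hj => by simp [Nat.lt_one_iff.1 hj, hab]) (by simp) (by simpa using hbT)).1 0
  simp only [Fin.val_zero, if_true, zero_add, one_ne_zero, if_false] at hlaw
  rw [← hlaw, integral_map (hz.measurable_normIncr le_rfl hab.le hbT).aemeasurable
    (f := fun g => h (transition lam sig f ℓ a₀ b x g))
    (hm.comp (measurable_transition_right lam sig f ℓ a₀ b x)).aestronglyMeasurable]
  refine integral_congr_ae ?_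
  filter_upwards [hz.ae_start (hab.le.trans hbT)] with ω hω
  have := transition_normIncr (lam := lam) (f := f) (ℓ := ℓ) hsig ha₀ hab fun r => z r ω
  simp only [hω] at this
  rw [this]

/-- The gradient formula for the transition semigroup. -/
lemma hasFDerivAt_transition (hsig : ∀ p, 0 < sig p ^ 2) {a b : ℝ} (ha : 0 ≤ a) (hab : a < b)
    {h : EuclideanSpace ℝ (Fin N) → ℝ} (hm : Measurable h) {C : ℝ} (hC : ∀ y, |h y| ≤ C)
    (y : EuclideanSpace ℝ (Fin N)) :
    ∃ φ : EuclideanSpace ℝ (Fin N) →L[ℝ] ℝ,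
      HasFDerivAt (fun y => ∫ g, h (transition lam sig f ℓ a b y g)
        ∂(stdGaussian (EuclideanSpace ℝ (Fin N)))) φ y ∧
      ∀ v, φ v = ∫ g, h (transition lam sig f ℓ a b y g) * gradWeight lam sig ℓ a b v g
        ∂(stdGaussian (EuclideanSpace ℝ (Fin N))) :=
  hasFDerivAt_integral_affine_stdGaussian hm hC (actL (expMat (-Matrix.diagonal lam) (b - a)))
    (actL (sqrtMat (covMat (-Matrix.diagonal lam) (Matrix.diagonal fun p => sig p ^ 2) ℓ a b)))
    (actL (invSqrtMat (covMat (-Matrix.diagonal lam) (Matrix.diagonal fun p => sig p ^ 2) ℓ a b)))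
    (fun x => act_sqrtMat_act_invSqrtMat (covMat_eq_diagonal lam sig ℓ a b)
      (covDiag_pos hsig ℓ ha hab) x)
    (driftInt (-Matrix.diagonal lam) f a b) y

/-- One step of the iteration preserves boundedness and measurability. -/
lemma measurable_bounded_integral_gradWeight {a b : ℝ}
    {h : EuclideanSpace ℝ (Fin N) → ℝ} (hm : Measurable h) {C : ℝ} (hC : ∀ y, |h y| ≤ C)
    {v : EuclideanSpace ℝ (Fin N) → EuclideanSpace ℝ (Fin N)} (hv : Measurable v) {D : ℝ}
    (hD : ∀ y, ‖v y‖ ≤ D) :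
    Measurable (fun y => ∫ g, h (transition lam sig f ℓ a b y g) * gradWeight lam sig ℓ a b (v y) g
        ∂(stdGaussian (EuclideanSpace ℝ (Fin N)))) ∧
      ∃ K, ∀ y, |∫ g, h (transition lam sig f ℓ a b y g) * gradWeight lam sig ℓ a b (v y) g
        ∂(stdGaussian (EuclideanSpace ℝ (Fin N)))| ≤ K := by
  constructor
  · have h1 : Measurable fun x : EuclideanSpace ℝ (Fin N) × EuclideanSpace ℝ (Fin N) =>
        h (transition lam sig f ℓ a b x.1 x.2) := hm.comp (measurable_transition lam sig f ℓ a b)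
    have h2 := measurable_gradWeight lam sig ℓ a b hv
    exact (h1.mul h2).stronglyMeasurable.integral_prod_right'.measurable
  · obtain ⟨K, hK0, hK⟩ := abs_gradWeight_le lam sig ℓ a b
    have hC0 : 0 ≤ C := (abs_nonneg _).trans (hC 0)
    refine ⟨∫ g, C * (K * D * ‖g‖) ∂(stdGaussian (EuclideanSpace ℝ (Fin N))), fun y => ?_⟩
    have hint : Integrable (fun g => C * (K * D * ‖g‖))
        (stdGaussian (EuclideanSpace ℝ (Fin N))) :=
      (integrable_norm_stdGaussian.const_mul (K * D)).const_mul C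
    rw [← Real.norm_eq_abs]
    refine norm_integral_le_of_norm_le hint (Eventually.of_forall fun g => ?_)
    have h1 := hC (transition lam sig f ℓ a b y g)
    have h2 := (hK (v y) g).trans (mul_le_mul_of_nonneg_right
      (mul_le_mul_of_nonneg_left (hD y) hK0) (norm_nonneg g))
    rw [Real.norm_eq_abs, abs_mul]
    exact mul_le_mul h1 h2 (abs_nonneg _) hC0

/-- The iterated functions in terms of the standard Gaussian measure. -/
lemma kIter_step [IsProbabilityMeasure P] (hW : IsBrownianVector W P)
    (hlam : ∀ p, 0 < lam p) (hsig : ∀ p, 0 < sig p ^ 2) (hf : ContinuousOn f (Icc 0 T))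
    {Z : TimeChange → ℝ → EuclideanSpace ℝ (Fin N) → ℝ → Ω → EuclideanSpace ℝ (Fin N)}
    (B : ℝ → EuclideanSpace ℝ (Fin N) → EuclideanSpace ℝ (Fin N))
    (u₀ : EuclideanSpace ℝ (Fin N) → ℝ) (ℓ : ℕ → TimeChange) (τ : ℕ → ℝ) (m : ℕ)
    (hZ : ∀ y, IsOUProcess (-Matrix.diagonal lam) (Matrix.diagonal fun p => sig p ^ 2) f T W P
      (ℓ m) (τ (m + 1)) y (Z (ℓ m) (τ (m + 1)) y))
    (h0 : 0 ≤ τ (m + 1)) (hlt : τ (m + 1) < τ m) (hT : τ m ≤ T)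
    (hm : Measurable (kIter P Z B u₀ ℓ τ m)) {C : ℝ} (hC : ∀ y, |kIter P Z B u₀ ℓ τ m y| ≤ C) :
    (∀ y, Integrable (fun ω => kIter P Z B u₀ ℓ τ m (Z (ℓ m) (τ (m + 1)) y (τ m) ω)) P) ∧
    Differentiable ℝ (fun y => ∫ ω, kIter P Z B u₀ ℓ τ m (Z (ℓ m) (τ (m + 1)) y (τ m) ω) ∂P) ∧
    ∀ y, kIter P Z B u₀ ℓ τ (m + 1) y
      = ∫ g, kIter P Z B u₀ ℓ τ m (transition lam sig f (ℓ m) (τ (m + 1)) (τ m) y g)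
        * gradWeight lam sig (ℓ m) (τ (m + 1)) (τ m) (B (τ (m + 1)) y) g
        ∂(stdGaussian (EuclideanSpace ℝ (Fin N))) := by
  have hZm : ∀ y, Measurable (Z (ℓ m) (τ (m + 1)) y (τ m)) := fun y =>
    (hZ y).measurable _ ⟨hlt.le, hT⟩
  have hfun : (fun y => ∫ ω, kIter P Z B u₀ ℓ τ m (Z (ℓ m) (τ (m + 1)) y (τ m) ω) ∂P)
      = fun y => ∫ g, kIter P Z B u₀ ℓ τ m (transition lam sig f (ℓ m) (τ (m + 1)) (τ m) y g)
        ∂(stdGaussian (EuclideanSpace ℝ (Fin N))) :=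
    funext fun y => (hZ y).integral_comp hW hlam hsig hf h0 hlt hT hm
  have hderiv := hasFDerivAt_transition (lam := lam) (f := f) (ℓ := ℓ m) hsig h0 hlt hm hC
  refine ⟨fun y => Integrable.of_bound (hm.comp (hZm y)).aestronglyMeasurable C
    (Eventually.of_forall fun ω => hC _), ?_, fun y => ?_⟩
  · rw [hfun]
    intro y
    obtain ⟨φ, hφ, _⟩ := hderiv y
    exact hφ.differentiableAt
  · obtain ⟨φ, hφ, hφv⟩ := hderiv y
    rw [kIter, hfun]
    beta_reduce
    -- By Riesz duality, pairing the gradient with `B` evaluates the derivative `φ` at `B`, where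
    -- its Gaussian formula is known.
    rw [(hasFDerivAt_iff_hasGradientAt.1 hφ).gradient, real_inner_comm,
      InnerProductSpace.toDual_symm_apply, hφv]

/-- Independence and law of the normalised increments, for times listed backwards. -/
lemma IsOUProcess.normIncr_iid_backward [IsProbabilityMeasure P] (hW : IsBrownianVector W P)
    (hlam : ∀ p, 0 < lam p) (hsig : ∀ p, 0 < sig p ^ 2) (hf : ContinuousOn f (Icc 0 T))
    {τ : ℕ → ℝ} {M : ℕ} (hτ : ∀ j < M, τ (j + 1) < τ j) (h0 : 0 ≤ τ M) (hT : τ 0 ≤ T)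
    (hz : IsOUProcess (-Matrix.diagonal lam) (Matrix.diagonal fun p => sig p ^ 2)
      f T W P ℓ (τ M) x z) :
    (∀ j < M, P.map (fun ω => normIncr (-Matrix.diagonal lam)
        (Matrix.diagonal fun p => sig p ^ 2) f ℓ (fun r => z r ω) (τ (j + 1)) (τ j))
      = stdGaussian (EuclideanSpace ℝ (Fin N))) ∧
    iIndepFun (fun (j : Fin M) ω => normIncr (-Matrix.diagonal lam)
      (Matrix.diagonal fun p => sig p ^ 2) f ℓ (fun r => z r ω) (τ (j + 1)) (τ j)) P := by
  have hθs : ∀ l < M, τ (M - l) < τ (M - (l + 1)) := fun l hl => by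
    have h1 : M - l = M - (l + 1) + 1 := by omega
    rw [h1]
    exact hτ _ (by omega)
  -- Times are reversed to increase. Truncated subtraction keeps `τ (M - l)` constant for `l ≥ M`,
  -- so monotonicity holds beyond the range in use.
  have hiid := hz.normIncr_iid hW hlam hsig hf h0 (M := M) (θ := fun l => τ (M - l))
    (monotone_nat_of_le_succ fun l => by
      rcases lt_or_ge l M with hl | hl
      · exact (hθs l hl).le
      · rw [show M - l = M - (l + 1) by omega])
    hθs le_rfl (by simpa using hT)
  have hrev : ∀ j : Fin M, (fun ω => normIncr (-Matrix.diagonal lam)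
      (Matrix.diagonal fun p => sig p ^ 2) f ℓ (fun r => z r ω) (τ (M - (Fin.rev j : ℕ)))
      (τ (M - ((Fin.rev j : ℕ) + 1))))
      = fun ω => normIncr (-Matrix.diagonal lam)
        (Matrix.diagonal fun p => sig p ^ 2) f ℓ (fun r => z r ω) (τ (j + 1)) (τ j) := by
    intro j
    have h1 : M - (Fin.rev j : ℕ) = j + 1 := by rw [Fin.val_rev]; omega
    have h2 : M - ((Fin.rev j : ℕ) + 1) = j := by rw [Fin.val_rev]; omega
    rw [h1, h2]
  constructor
  · intro j hj
    exact (congrArg (fun g => P.map g) (hrev ⟨j, hj⟩).symm).trans (hiid.1 (Fin.rev ⟨j, hj⟩))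
  · have h := hiid.2.precomp Fin.rev_injective
    have e := (funext hrev).symm
    rw [e]
    exact h

end Step

/-- In a finite independent family, the last variable may be replaced by a function of it. -/
lemma iIndepFun_replace_last {Ω E : Type*} [MeasurableSpace Ω] {P : Measure Ω} [MeasurableSpace E]
    {M : ℕ} {G : ℕ → Ω → E} (hG : iIndepFun (fun j : Fin (M + 1) => G j) P) {φ : E → E}
    (hφ : Measurable φ) {U : Ω → E} (hU : ∀ᵐ ω ∂P, φ (G M ω) = U ω) :
    iIndepFun (fun j : Fin (M + 1) => if (j : ℕ) < M then G j else U) P := by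
  have h := hG.comp (fun j => if (j : ℕ) < M then id else φ) fun j => by
    split_ifs
    exacts [measurable_id, hφ]
  refine h.congr fun j => ?_
  by_cases hj : (j : ℕ) < M
  · simp [hj]
  · have hj' : (j : ℕ) = M := by omega
    filter_upwards [hU] with ω hω
    simp [hj', hω]

end OUIter

end

/-! ### The conditional representation of the iterated functions -/

theorem lemma6p1 {N : ℕ} {Ω : Type*} [MeasurableSpace Ω] (P : Measure Ω) [IsProbabilityMeasure P]
    (W : ℝ≥0 → Ω → EuclideanSpace ℝ (Fin N)) (hW : OUIter.IsBrownianVector W P)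
    -- the matrices `A = -diag(λ)` and `Q = diag(σ²)`
    (lam sig : Fin N → ℝ) (hlam : ∀ p, 0 < lam p) (hsig : ∀ p, 0 < sig p ^ 2)
    (A Q : Matrix (Fin N) (Fin N) ℝ) (hA : A = -Matrix.diagonal lam)
    (hQ : Q = Matrix.diagonal fun p => sig p ^ 2)
    (T : ℝ) (f : ℝ → EuclideanSpace ℝ (Fin N)) (hf : ContinuousOn f (Icc 0 T))
    -- the vector field `B = B₀ - f`
    (B₀ B : ℝ → EuclideanSpace ℝ (Fin N) → EuclideanSpace ℝ (Fin N))
    (hB₀cont : ∀ r ∈ Icc 0 T, Continuous (B₀ r))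
    (hB₀bdd : ∃ C : ℝ, ∀ r ∈ Icc 0 T, ∀ y, ‖B₀ r y‖ ≤ C)
    (hB : ∀ r y, B r y = B₀ r y - f r)
    (u₀ : EuclideanSpace ℝ (Fin N) → ℝ) (hu₀ : Measurable u₀) (hu₀bdd : ∃ C : ℝ, ∀ y, |u₀ y| ≤ C)
    -- the Ornstein-Uhlenbeck processes `Z^ℓ(a, x)`
    (Z : OUIter.TimeChange → ℝ → EuclideanSpace ℝ (Fin N) → ℝ → Ω → EuclideanSpace ℝ (Fin N))
    (hZ : ∀ ℓ a x, 0 ≤ a → a < T → OUIter.IsOUProcess A Q f T W P ℓ a x (Z ℓ a x))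
    (s t : ℝ) (hs : 0 ≤ s) (hst : s < t) (htT : t ≤ T) (n : ℕ) (hn : 1 ≤ n)
    (x : EuclideanSpace ℝ (Fin N)) (i : ℕ) (hi : i ≤ n)
    -- the times `s ≤ s_{n-i} < ⋯ < s_{n+1} < t = s_{n+2}`
    (ts : ℕ → ℝ) (hts : s ≤ ts (n - i)) (hmono : StrictMonoOn ts (Icc (n - i) (n + 1)))
    (htn : ts (n + 1) < t) (htl : ts (n + 2) = t)
    (ℓ : ℕ → OUIter.TimeChange) :
    -- backward enumeration, `τ_j = s_{n+2-j}`
    let τ : ℕ → ℝ := fun j => ts (n + 2 - j)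
    let k : ℕ → EuclideanSpace ℝ (Fin N) → ℝ := OUIter.kIter P Z B u₀ ℓ τ
    -- the path `r ↦ Z^{ℓ^{i+1}}_r(s_{n-i}, x)`
    let ζ : Ω → ℝ → EuclideanSpace ℝ (Fin N) := fun ω r => Z (ℓ (i + 1)) (τ (i + 2)) x r ω
    let Y : Ω → ℕ → EuclideanSpace ℝ (Fin N) := fun ω =>
      OUIter.rescaledState A Q f ℓ τ (i + 1) (ζ ω)
    let Φ : Ω → ℝ := fun ω =>
      u₀ (Y ω 0) *
        ∏ j ∈ Finset.Icc 1 (i + 1),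
          ⟪OUIter.act (OUIter.invSqrtMat (OUIter.covMat A Q (ℓ (j - 1)) (τ j) (τ (j - 1))))
              (OUIter.act (OUIter.expMat A (τ (j - 1) - τ j)) (B (τ j) (Y ω j))),
            OUIter.normIncr A Q f (ℓ (i + 1)) (ζ ω) (τ j) (τ (j - 1))⟫
    -- the expectations and gradients that define `k` exist
    (∀ m ≤ i,
      (∀ y, Integrable (fun ω => k m (Z (ℓ m) (τ (m + 1)) y (τ m) ω)) P) ∧
      Differentiable ℝ (fun y => ∫ ω, k m (Z (ℓ m) (τ (m + 1)) y (τ m) ω) ∂P)) ∧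
    Integrable Φ P ∧
    (fun ω => k (i + 1) (Z (ℓ (i + 1)) (τ (i + 2)) x (τ (i + 1)) ω)) =ᵐ[P]
      P[Φ | MeasurableSpace.comap (Z (ℓ (i + 1)) (τ (i + 2)) x (τ (i + 1))) inferInstance] := by
  subst hA hQ
  intro τ k ζ Y Φ
  set γ := stdGaussian (EuclideanSpace ℝ (Fin N)) with hγ
  have hτ : ∀ j ≤ i + 1, τ (j + 1) < τ j := by
    intro j hj
    simp only [τ]
    -- The time `t = ts (n + 2)` lies outside the range of `hmono`, so the comparison with it is
    -- separate.
    rcases Nat.eq_zero_or_pos j with rfl | hj0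
    · simpa [htl] using htn
    · refine hmono ⟨by omega, by omega⟩ ⟨by omega, by omega⟩ (by omega)
  have hanti : ∀ j l, j ≤ l → l ≤ i + 2 → τ l ≤ τ j := by
    intro j l hjl
    induction l, hjl using Nat.le_induction with
    | base => exact fun _ => le_rfl
    | succ l _ ih => exact fun hl => (hτ l (by omega)).le.trans (ih (by omega))
  have hτT : ∀ j ≤ i + 2, τ j ≤ T := fun j hj =>
    (hanti 0 j j.zero_le hj).trans (by simpa [τ, htl] using htT)
  have hτ0 : ∀ j ≤ i + 2, 0 ≤ τ j := by
    intro j hj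
    refine hs.trans (le_trans ?_ (hanti j (i + 2) hj le_rfl))
    have : n + 2 - (i + 2) = n - i := by omega
    simpa only [τ, this] using hts
  have hOU : ∀ m ≤ i + 1, ∀ ℓ' y, OUIter.IsOUProcess (-Matrix.diagonal lam)
      (Matrix.diagonal fun p => sig p ^ 2) f T W P ℓ' (τ (m + 1)) y (Z ℓ' (τ (m + 1)) y) :=
    fun m hm ℓ' y => hZ ℓ' _ y (hτ0 _ (by omega)) ((hτ m hm).trans_le (hτT m (by omega)))
  have hBc : ∀ j ≤ i + 2, Continuous (B (τ j)) := by
    intro j hj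
    have : B (τ j) = fun y => B₀ (τ j) y - f (τ j) := funext (hB (τ j))
    rw [this]
    exact (hB₀cont _ ⟨hτ0 j hj, hτT j hj⟩).sub continuous_const
  have hBb : ∀ j ≤ i + 2, ∃ D, ∀ y, ‖B (τ j) y‖ ≤ D := by
    intro j hj
    obtain ⟨C, hC⟩ := hB₀bdd
    refine ⟨C + ‖f (τ j)‖, fun y => ?_⟩
    rw [hB]
    exact (norm_sub_le _ _).trans (add_le_add_left (hC _ ⟨hτ0 j hj, hτT j hj⟩ y) _)
  set Ψ : ℕ → EuclideanSpace ℝ (Fin N) → EuclideanSpace ℝ (Fin N) → EuclideanSpace ℝ (Fin N) :=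
    fun j => OUIter.transition lam sig f (ℓ j) (τ (j + 1)) (τ j) with hΨ
  set q : ℕ → EuclideanSpace ℝ (Fin N) → EuclideanSpace ℝ (Fin N) → ℝ := fun j y g =>
    OUIter.gradWeight lam sig (ℓ j) (τ (j + 1)) (τ j) (B (τ (j + 1)) y) g with hq
  have hstep := fun m (hm : m ≤ i) hkm C hC => OUIter.kIter_step (Z := Z) hW hlam hsig hf B u₀ ℓ τ m
    (hOU m (by omega) (ℓ m)) (hτ0 _ (by omega)) (hτ m (by omega)) (hτT m (by omega)) hkm (C := C) hC
  -- Boundedness and measurability of one iterate give the gradient formula for the next, and that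
  -- formula in turn gives its boundedness and measurability.
  have hreg : ∀ m ≤ i + 1, Measurable (k m) ∧ ∃ C, ∀ y, |k m y| ≤ C := by
    intro m
    induction m with
    | zero => exact fun _ => ⟨hu₀, hu₀bdd⟩
    | succ m ih =>
      intro hm
      obtain ⟨h1, C, hC⟩ := ih (by omega)
      obtain ⟨D, hD⟩ := hBb (m + 1) (by omega)
      have hrec : k (m + 1) = fun y => ∫ g, k m (Ψ m y g) * q m y g ∂γ :=
        funext (hstep m (by omega) h1 C hC).2.2
      rw [hrec]
      exact OUIter.measurable_bounded_integral_gradWeight h1 hC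
        (hBc (m + 1) (by omega)).measurable hD
  refine ⟨fun m hm => ?_, ?_⟩
  · obtain ⟨h1, C, hC⟩ := hreg m (by omega)
    exact ⟨(hstep m hm h1 C hC).1, (hstep m hm h1 C hC).2.1⟩
  have hz := hOU (i + 1) le_rfl (ℓ (i + 1)) x
  -- Counted from zero, `G j` is the `G_{j+1}` of the statement. The additional `G (i + 1)` belongs
  -- to the interval from the starting time `τ (i + 2)` to `τ (i + 1)`.
  set G : ℕ → Ω → EuclideanSpace ℝ (Fin N) := fun j ω =>
    OUIter.normIncr (-Matrix.diagonal lam) (Matrix.diagonal fun p => sig p ^ 2) f (ℓ (i + 1))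
      (ζ ω) (τ (j + 1)) (τ j) with hG
  have hGm : ∀ j ≤ i + 1, Measurable (G j) := fun j hj =>
    hz.measurable_normIncr (hanti _ _ (by omega) le_rfl) (hτ j hj).le (hτT j (by omega))
  obtain ⟨hGlaw, hGind⟩ := hz.normIncr_iid_backward hW hlam hsig hf (τ := τ) (M := i + 2)
    (fun j hj => hτ j (by omega)) (hτ0 _ le_rfl) (hτT 0 (by omega))
  set V : ℕ → Ω → EuclideanSpace ℝ (Fin N) := fun j =>
    if j < i + 1 then G j else fun ω => ζ ω (τ (i + 1)) with hV
  have hV1 : ∀ j < i + 1, V j = G j := fun j hj => if_pos hj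
  have hV2 : V (i + 1) = fun ω => ζ ω (τ (i + 1)) := if_neg (lt_irrefl _)
  have hVm : ∀ j ≤ i + 1, Measurable (V j) := by
    intro j hj
    rcases hj.lt_or_eq with h | rfl
    · rw [hV1 j h]; exact hGm j hj
    · rw [hV2]
      exact hz.measurable _ ⟨(hτ _ le_rfl).le, hτT _ (by omega)⟩
  -- The start `x` is deterministic, so the state at `τ (i + 1)` is a.s. a function of `G (i + 1)`
  -- alone and may replace it in the independent family.
  have hVind : iIndepFun (fun j : Fin (i + 1 + 1) => V j) P := by
    refine OUIter.iIndepFun_replace_last (G := G) hGind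
      (OUIter.measurable_transition_right lam sig f (ℓ (i + 1)) (τ (i + 2)) (τ (i + 1)) x) ?_
    filter_upwards [hz.ae_start (hτT _ le_rfl)] with ω hω
    have h := OUIter.transition_normIncr (lam := lam) (f := f) (ℓ := ℓ (i + 1)) hsig
      (hτ0 (i + 2) le_rfl) (hτ (i + 1) le_rfl) (ζ ω)
    rwa [show ζ ω (τ (i + 2)) = x from hω] at h
  have hYrec : ∀ j < i + 1, ∀ ω, Y ω j = Ψ j (Y ω (j + 1)) (V j ω) := by
    intro j hj ω
    rw [hV1 j hj]
    exact OUIter.rescaledState_succ lam _ f ℓ τ hj (ζ ω)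
  have hYend : (fun ω => Y ω (i + 1)) = V (i + 1) := by
    rw [hV2]
    ext1 ω
    exact OUIter.rescaledState_self lam _ f ℓ τ (i + 1) (ζ ω)
  have hchain := OUIter.condExp_chain (P := P) (M := i + 1) (γ := γ)
    OUIter.integrable_norm_stdGaussian hVm hVind
    (fun j hj => by rw [hV1 j hj]; exact hGlaw j (by omega)) (Y := fun j ω => Y ω j) (Ψ := Ψ)
    (fun j _ => OUIter.measurable_transition lam sig f _ _ _) hYend hYrec (q := q)
    (fun j hj => OUIter.measurable_gradWeight lam sig (ℓ j) (τ (j + 1)) (τ j)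
      (hBc (j + 1) (by omega)).measurable)
    (fun j hj => by
      obtain ⟨D, hD⟩ := hBb (j + 1) (by omega)
      obtain ⟨K, hK0, hK⟩ := OUIter.abs_gradWeight_le lam sig (ℓ j) (τ (j + 1)) (τ j)
      refine ⟨K * D, fun y g => (hK _ _).trans ?_⟩
      gcongr
      exact hD y)
    (k := k) (fun j hj => (hreg j hj).1) (fun j hj => (hreg j hj).2)
    (fun j hj => by
      obtain ⟨h1, C, hC⟩ := hreg j hj.le
      exact (hstep j (by omega) h1 C hC).2.2)
  -- The product over `1, …, i + 1` in the statement is shifted to start at `0`.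
  have hΦ : (fun ω => k 0 (Y ω 0) * ∏ j ∈ Finset.range (i + 1), q j (Y ω (j + 1)) (V j ω)) = Φ := by
    ext ω
    have hIcc : Finset.Icc 1 (i + 1) = Finset.Ico 1 (i + 2) := rfl
    simp only [Φ, hIcc, Finset.prod_Ico_eq_prod_range]
    congr 1
    refine Finset.prod_congr rfl fun j hj => ?_
    rw [hV1 j (Finset.mem_range.1 hj)]
    simp only [add_comm 1 j, add_tsub_cancel_right]
    rfl
  rw [hΦ, hV2] at hchain
  exact hchain
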